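/- Let $K_\nu(x)=\int_0^\infty e^{-x\cosh t}\cosh(\nu t)\,dt$ ($\nu\in\mathbb R$, $x>0$), let $0<\beta<\alpha$, $\gamma=\sqrt{\alpha^2-\beta^2}$, and let either $\delta>0$ and $\lambda\in\mathbb R$, or $\delta=0$ and $\lambda>0$. For $\delta>0$ the law $GH(\lambda,\alpha,\beta,\delta,0)$ on $\mathbb R$ has density $$p(x)=\frac{(\gamma/\delta)^\lambda}{\sqrt{2\pi}K_\lambda(\delta\gamma)}e^{\beta x}\frac{K_{\lambda-1/2}(\alpha\sqrt{\delta^2+x^2})}{(\sqrt{\delta^2+x^2}/\alpha)^{1/2-\lambda}},$$ and for $\delta=0$ it has the limiting density $$p(x)=\frac{\gamma^{2\lambda}}{\sqrt\pi\,\Gamma(\lambda)}\Big(\frac{|x|}{2\alpha}\Big)^{\lambda-1/2}e^{\beta x}K_{\lambda-1/2}(\alpha|x|),$$ extended to $x=0$ by continuity with values in $[0,\infty]$. For all these parameters the density has exactly one maximum point $M$, the mode of the law. Put $$b_a(\lambda,\alpha,\beta,\delta)=\frac{\beta}{\gamma^2}\Big[\lambda-a+\sqrt{(\lambda-a)^2+\delta^2\gamma^2}\Big],\qquad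 c(\lambda,\alpha,\beta,\delta)=\frac{\beta}{\gamma^2}\bigg[\lambda-1+\sqrt{(\lambda-1)^2+\gamma^2\Big(\delta^2+\frac{3-2\lambda}{\alpha^2}\Big)}\bigg].$$ (i) For $\delta>0$ and $\lambda\in\mathbb R$, $b_{3/2}<M<b_{1/2}$. The lower bound also holds for $\delta=0$, $\lambda>3/2$, and the upper bound also holds for $\delta=0$, $\lambda>1/2$. For $\delta>0$: $M<b_1$ if $\lambda>1$, $M=b_1$ if $\lambda=1$, and $M>b_1$ if $\lambda<1$. Also, for $\delta=0$: $M<b_1$ if $\lambda>1$, and $M=b_1=0$ if $\lambda=1$. For $\delta>0$: $M>c$ if $\lambda>2$, $M=c$ if $\lambda=2$, and $M<c$ if $\lambda<2$. For $\delta=0$: $M>c$ if $\lambda>2$, $M=c$ if $\lambda=2$, and $M<c$ if $1<\lambda<2$. (ii) The bounds $b_{3/2}$ and $b_{1/2}$ are both asymptotically equivalent to $M$ (the ratio tends to $1$) as $\lambda\to\infty$ with $\alpha,\beta$ and $\delta\ge0$ fixed, and as $\delta\to\infty$ with $\lambda\in\mathbb R$, $\alpha,\beta$ fixed. Let $\sigma=1/\gamma$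 and $\theta=\beta/\gamma^2$, so that $\beta=\theta/\sigma^2$ and $\alpha=\sqrt{\theta^2+\sigma^2}/\sigma^2$. For fixed $\theta>0$, $\lambda$ and $\delta$, as $\sigma\to\infty$, $$M\sim\begin{cases}\theta(2\lambda-3),&\lambda>3/2,\ \delta\ge0,\\[4pt] \dfrac{\theta}{\log\sigma},&\lambda=3/2,\ \delta\ge0,\\[8pt] \dfrac{2^{2\lambda-2}\Gamma(\lambda-\frac12)}{\Gamma(\frac32-\lambda)}\,\dfrac{\theta\delta^{3-2\lambda}}{\sigma^{3-2\lambda}},&1/2<\lambda<3/2,\ \delta>0,\\[8pt] \dfrac{\theta\delta^2}{(1-2\lambda)\sigma^2},&\lambda<1/2,\ \delta>0.\end{cases}$$ If $\delta=0$ and $0<\lambda\le1$, then $M=0$. If $\delta=0$ and $\lambda>1$, then $M\sim2\theta(\lambda-1)$ as $\sigma\downarrow0$ for fixed $\theta>0$. The constants $a=3/2$ (lower bound), $a=1/2$ (upper bound) and $a=1$ (upper bound for $\lambda>1$) are best possible, in the following sense, for $a\in\mathbb R$. If for some $\lambda>3/2$ and $\delta\ge0$ one has $b_a\le M$ for all $0<\beta<\alpha$,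 then $a\ge3/2$. If for some $\lambda<1/2$ and $\delta>0$ one has $M\le b_a$ for all $0<\beta<\alpha$, then $a\le1/2$. If for $\delta=0$ and some $\lambda>1$ one has $M\le b_a$ for all $0<\beta<\alpha$, then $a\le1$; likewise if $M\le b_a$ for all $\lambda>1$, $\delta>0$ and $0<\beta<\alpha$, then $a\le1$. -/

import Mathlib

open Real Set Filter Topology MeasureTheory Asymptotics
open scoped ENNReal

noncomputable section

/-- The modified Bessel function of the second kind `K_ν(x)`, for real `ν` and `x > 0`. -/
def besselK (ν x : ℝ) : ℝ :=
  ∫ t in Ioi (0 : ℝ), exp (-x * cosh t) * cosh (ν * t)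

/-- The parameter `γ = √(α² - β²)`. -/
def ghGamma (α β : ℝ) : ℝ := √(α ^ 2 - β ^ 2)

/-- The density of the variance-gamma law, which is `GH(l, α, β, 0, 0)`, for `l > 0`, `|β| < α`.
Its value at the single point `x = 0` plays no role. -/
def vgPDF (l α β x : ℝ) : ℝ :=
  ghGamma α β ^ (2 * l) / (√π * Gamma l) * (|x| / (2 * α)) ^ (l - 1 / 2) * exp (β * x)
    * besselK (l - 1 / 2) (α * |x|)

/-- The density of the generalized hyperbolic law `GH(l, α, β, δ, 0)`, for `|β| < α` and either
`δ > 0`, or `δ = 0` and `l > 0`. -/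
def ghPDF (l α β δ x : ℝ) : ℝ :=
  if δ = 0 then vgPDF l α β x
  else
    (ghGamma α β / δ) ^ l / (√(2 * π) * besselK l (δ * ghGamma α β)) * exp (β * x)
      * (besselK (l - 1 / 2) (α * √(δ ^ 2 + x ^ 2)) / (√(δ ^ 2 + x ^ 2) / α) ^ (1 / 2 - l))

/-- The generalized hyperbolic law `GH(l, α, β, δ, 0)`. -/
def ghLaw (l α β δ : ℝ) : Measure ℝ :=
  volume.withDensity fun x => ENNReal.ofReal (ghPDF l α β δ x)

/-- `M` is a mode of the law `μ` on the line: `μ` has a continuous density with values in `[0, ∞]`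
(which is then unique; the value `∞` allows for a pole), and this density is maximal at `M`. -/
def IsMode (μ : Measure ℝ) (M : ℝ) : Prop :=
  ∃ f : ℝ → ℝ≥0∞, Continuous f ∧ μ = volume.withDensity f ∧ ∀ x, f x ≤ f M

/-- `b_a(l, α, β, δ) = (β/γ²) [l - a + √((l - a)² + δ²γ²)]`. -/
def modeBound (a l α β δ : ℝ) : ℝ :=
  β / ghGamma α β ^ 2 * (l - a + √((l - a) ^ 2 + δ ^ 2 * ghGamma α β ^ 2))

/-- `(β/γ²) [l - 1 + √((l - 1)² + γ² (δ² + (3 - 2l)/α²))]`. -/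
def modeBoundShifted (l α β δ : ℝ) : ℝ :=
  β / ghGamma α β ^ 2
    * (l - 1 + √((l - 1) ^ 2 + ghGamma α β ^ 2 * (δ ^ 2 + (3 - 2 * l) / α ^ 2)))

/-- The law `GH(l, α, β, δ, 0)` in the parameters `θ = β/γ²`, `σ = 1/γ`, that is, with
`β = θ/σ²` and `α = √(θ² + σ²)/σ²` (`σ > 0`). -/
def ghLawThetaSigma (l θ σ δ : ℝ) : Measure ℝ :=
  ghLaw l (√(θ ^ 2 + σ ^ 2) / σ ^ 2) (θ / σ ^ 2) δ

end

noncomputable section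

/-! Put `ν = l - 1/2` and `H_ν(y) = y K_ν(y) / K_{ν-1}(y)` (`besselRatio`). Where the density is
smooth (everywhere if `δ > 0`, off the origin if `δ = 0`), its derivative is a positive factor times
`β H_ν(α√(δ²+x²)) - α² x`. This difference is positive for `x < 0`, and on `x > 0` it can pass only
once from positive to negative (`besselRatio_crossing`). So the mode is the unique positive solution
of `α² M = β H_ν(y)`, `y = α√(δ²+M²)`, except that it is `0` when `δ = 0` and `l ≤ 1`.

For `r = γ² M / β` the critical equation makes `r² - 2cr - γ²(δ² + k/α²)` a positive multiple of `H²
- 2cH - y² - k` (`quadratic_mode_eq`). Every bound in (i) is thus the sign of a quadratic in `H_ν`.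
With `k = 0`, the cases `c = ν` and `c = ν - 1` are Turán's inequality at the orders `ν` and `ν -
1`. The case `c = ν - 1/2` (`besselRatio_middle_neg`, `besselRatio_middle_pos`) comes from the
Riccati equation for `H_ν` and the reflection `H_ν H_{1-ν} = y²`. The recurrence carries it from
order `ν - 1` to order `ν`, which gives the case `k = 2 - 2ν`, that is, the bound `c(l, α, β, δ)`.

For `σ → ∞` the argument `y` tends to `0`, and the four regimes are those of `H_ν` at the origin;
for `δ = 0`, `σ ↓ 0`, the argument tends to infinity and `H_ν(y) - y → ν - 1/2` decides. Sharpness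
follows by comparing these limits with those of `b_a`; for the last claim there is the exact case `l
= 2`. -/

/-! ### The Bessel function `K_ν`: Turán's inequality, derivative, recurrence, behaviour at the
origin. -/

theorem exp_neg_mul_cosh_add_mul_le {x : ℝ} (hx : 0 < x) (c t : ℝ) :
    exp (-x * cosh t + c * t) ≤ exp ((c + 1) ^ 2 / x) * exp (-1 * t) := by
  have hq : t ^ 2 / 4 ≤ cosh t := by
    have h1 := quadratic_le_exp_of_nonneg (abs_nonneg t)
    have h2 := exp_pos (-|t|)
    have h3 : cosh t = (exp |t| + exp (-|t|)) / 2 := by rw [← cosh_abs, cosh_eq]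
    have h4 : |t| ^ 2 = t ^ 2 := sq_abs t
    have := abs_nonneg t
    nlinarith
  rw [← exp_add]
  apply exp_le_exp.2
  have h1 : x * (t ^ 2 / 4) ≤ x * cosh t := by gcongr
  have h2 : (c + 1) * t ≤ x * t ^ 2 / 4 + (c + 1) ^ 2 / x := by
    have h3 : x * t ^ 2 / 4 + (c + 1) ^ 2 / x - (c + 1) * t = (x * t / 2 - (c + 1)) ^ 2 / x := by
      field_simp
      ring
    have : 0 ≤ (x * t / 2 - (c + 1)) ^ 2 / x := by positivity
    linarith
  linarith

theorem integrableOn_exp_neg_mul_cosh_add_mul {x : ℝ} (hx : 0 < x) (c : ℝ) :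
    IntegrableOn (fun t => exp (-x * cosh t + c * t)) (Ioi 0) := by
  refine integrable_of_isBigO_exp_neg (b := 1) one_pos (by fun_prop) ?_
  refine IsBigO.of_bound (exp ((c + 1) ^ 2 / x)) (Eventually.of_forall fun t => ?_)
  rw [norm_of_nonneg (exp_pos _).le, norm_of_nonneg (exp_pos _).le]
  exact exp_neg_mul_cosh_add_mul_le hx c t

theorem exp_mul_cosh_eq (x ν t : ℝ) : exp (-x * cosh t) * cosh (ν * t) =
    (1 / 2) * (exp (-x * cosh t + ν * t) + exp (-x * cosh t + -ν * t)) := by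
  rw [cosh_eq (ν * t), exp_add, exp_add, neg_mul ν t]
  ring

theorem integrableOn_besselK {x : ℝ} (hx : 0 < x) (ν : ℝ) :
    IntegrableOn (fun t => exp (-x * cosh t) * cosh (ν * t)) (Ioi 0) := by
  simp_rw [exp_mul_cosh_eq]
  exact ((integrableOn_exp_neg_mul_cosh_add_mul hx ν).add
    (integrableOn_exp_neg_mul_cosh_add_mul hx (-ν))).const_mul _

theorem setIntegral_Ioi_pos {f : ℝ → ℝ} (hf : IntegrableOn f (Ioi 0)) (hpos : ∀ t > 0, 0 < f t) :
    0 < ∫ t in Ioi (0 : ℝ), f t := by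
  rw [setIntegral_pos_iff_support_of_nonneg_ae]
  · have : Function.support f ∩ Ioi 0 = Ioi 0 :=
      inter_eq_right.2 fun t ht => (hpos t ht).ne'
    rw [this]
    simp
  · filter_upwards [ae_restrict_mem measurableSet_Ioi] with t ht using (hpos t ht).le
  · exact hf

theorem besselK_pos {x : ℝ} (hx : 0 < x) (ν : ℝ) : 0 < besselK ν x :=
  setIntegral_Ioi_pos (integrableOn_besselK hx ν) fun _ _ =>
    mul_pos (exp_pos _) (cosh_pos _)

theorem besselK_neg (ν x : ℝ) : besselK (-ν) x = besselK ν x := by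
  simp [besselK]

theorem besselK_lt_of_abs_lt {x : ℝ} (hx : 0 < x) {μ ν : ℝ} (h : |μ| < |ν|) :
    besselK μ x < besselK ν x := by
  have := setIntegral_Ioi_pos ((integrableOn_besselK hx ν).sub (integrableOn_besselK hx μ)) ?_
  · simp only [Pi.sub_apply] at this
    rw [integral_sub (integrableOn_besselK hx ν) (integrableOn_besselK hx μ)] at this
    exact sub_pos.1 this
  · intro t ht
    have : cosh (μ * t) < cosh (ν * t) := by
      rw [cosh_lt_cosh, abs_mul, abs_mul]
      exact mul_lt_mul_of_pos_right h (abs_pos.2 ht.ne')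
    simp only [Pi.sub_apply, ← mul_sub]
    exact mul_pos (exp_pos _) (sub_pos.2 this)

theorem besselK_le_of_abs_le {x : ℝ} (hx : 0 < x) {μ ν : ℝ} (h : |μ| ≤ |ν|) :
    besselK μ x ≤ besselK ν x := by
  rcases h.lt_or_eq with h | h
  · exact (besselK_lt_of_abs_lt hx h).le
  · rcases abs_eq_abs.1 h with h | h
    · rw [h]
    · rw [h, besselK_neg]

/-- A strict Cauchy–Schwarz inequality: the quadratic `K_{ν+1} - 2c K_ν + c² K_{ν-1}` has a
nonnegative integrand, built from the squares of `e^t - c` and `e^{-t} - c`, which do not vanish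
together for `t > 0`. It is then evaluated at its minimiser `c = K_ν / K_{ν-1}`. -/
theorem besselK_turan {x : ℝ} (hx : 0 < x) (ν : ℝ) :
    besselK ν x ^ 2 < besselK (ν - 1) x * besselK (ν + 1) x := by
  have key : ∀ c : ℝ, 0 < besselK (ν + 1) x + (-2 * c) * besselK ν x + c ^ 2 * besselK (ν - 1) x := by
    intro c
    have i1 := integrableOn_besselK hx (ν + 1)
    have i2 := (integrableOn_besselK hx ν).const_mul (-2 * c)
    have i3 := (integrableOn_besselK hx (ν - 1)).const_mul (c ^ 2)
    have h0 : ∀ t, exp (-x * cosh t) * cosh ((ν + 1) * t)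
        + (-2 * c) * (exp (-x * cosh t) * cosh (ν * t))
        + c ^ 2 * (exp (-x * cosh t) * cosh ((ν - 1) * t)) = exp (-x * cosh t) / 2 *
          (exp ((ν - 1) * t) * (exp t - c) ^ 2 + exp (-((ν - 1) * t)) * (exp (-t) - c) ^ 2) := by
      intro t
      have e1 : exp ((ν + 1) * t) = exp ((ν - 1) * t) * exp t ^ 2 := by
        rw [← exp_nat_mul, ← exp_add]; push_cast; ring_nf
      have e2 : exp (ν * t) = exp ((ν - 1) * t) * exp t := by
        rw [← exp_add]; ring_nf
      have e3 : exp (-((ν + 1) * t)) = exp (-((ν - 1) * t)) * exp (-t) ^ 2 := by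
        rw [← exp_nat_mul, ← exp_add]; push_cast; ring_nf
      have e4 : exp (-(ν * t)) = exp (-((ν - 1) * t)) * exp (-t) := by
        rw [← exp_add]; ring_nf
      simp only [cosh_eq ((ν + 1) * t), cosh_eq (ν * t), cosh_eq ((ν - 1) * t), e1, e2, e3, e4]
      ring
    have h1 := setIntegral_Ioi_pos ((i1.add i2).add i3) ?_
    · have e1 := integral_add (i1.add i2) i3
      have e2 := integral_add i1 i2
      rw [integral_const_mul] at e1 e2
      simp only [Pi.add_apply] at h1 e1 e2
      rw [e1, e2] at h1
      exact h1
    · intro t ht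
      simp only [Pi.add_apply]
      rw [h0]
      have hne : exp t ≠ exp (-t) := by
        intro h
        have := exp_injective h
        linarith
      by_cases hc : exp t = c
      · have : 0 < (exp (-t) - c) ^ 2 := by
          rw [← hc]
          exact sq_pos_of_ne_zero (sub_ne_zero.2 hne.symm)
        positivity
      · have : 0 < (exp t - c) ^ 2 := sq_pos_of_ne_zero (sub_ne_zero.2 hc)
        positivity
  have hp := besselK_pos hx (ν - 1)
  have h := key (besselK ν x / besselK (ν - 1) x)
  have h2 := mul_pos hp h
  have h3 : besselK (ν - 1) x * (besselK (ν + 1) x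
      + -2 * (besselK ν x / besselK (ν - 1) x) * besselK ν x
      + (besselK ν x / besselK (ν - 1) x) ^ 2 * besselK (ν - 1) x) =
      besselK (ν - 1) x * besselK (ν + 1) x - besselK ν x ^ 2 := by
    field_simp
    ring
  linarith

theorem cosh_mul_besselK_integrand (x ν t : ℝ) :
    cosh t * (exp (-x * cosh t) * cosh (ν * t)) =
      (1 / 2) * (exp (-x * cosh t) * cosh ((ν - 1) * t) + exp (-x * cosh t) * cosh ((ν + 1) * t)) := by
  rw [show (ν - 1) * t = ν * t - t by ring, show (ν + 1) * t = ν * t + t by ring, cosh_sub, cosh_add]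
  ring

theorem integral_cosh_mul_besselK_integrand {x : ℝ} (hx : 0 < x) (ν : ℝ) :
    IntegrableOn (fun t => cosh t * (exp (-x * cosh t) * cosh (ν * t))) (Ioi 0) ∧
      ∫ t in Ioi (0 : ℝ), cosh t * (exp (-x * cosh t) * cosh (ν * t)) =
        (besselK (ν - 1) x + besselK (ν + 1) x) / 2 := by
  simp_rw [cosh_mul_besselK_integrand]
  have i1 := integrableOn_besselK hx (ν - 1)
  have i2 := integrableOn_besselK hx (ν + 1)
  refine ⟨(i1.add i2).const_mul _, ?_⟩
  rw [integral_const_mul, integral_add i1 i2]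
  simp only [besselK]
  ring

theorem hasDerivAt_besselK {x : ℝ} (hx : 0 < x) (ν : ℝ) :
    HasDerivAt (besselK ν) (-(besselK (ν - 1) x + besselK (ν + 1) x) / 2) x := by
  have h := hasDerivAt_integral_of_dominated_loc_of_deriv_le
    (μ := volume.restrict (Ioi (0 : ℝ)))
    (F := fun y t => exp (-y * cosh t) * cosh (ν * t))
    (F' := fun y t => -(cosh t * (exp (-y * cosh t) * cosh (ν * t))))
    (x₀ := x) (s := Ioi (x / 2))
    (bound := fun t => cosh t * (exp (-(x / 2) * cosh t) * cosh (ν * t)))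
    (Ioi_mem_nhds (by linarith))
    (Eventually.of_forall fun y => (by fun_prop : Continuous _).aestronglyMeasurable)
    (integrableOn_besselK hx ν)
    (by fun_prop : Continuous _).aestronglyMeasurable
    (Eventually.of_forall fun t y hy => ?_)
    (integral_cosh_mul_besselK_integrand (half_pos hx) ν).1
    (Eventually.of_forall fun t y hy => ?_)
  · have h2 := h.2
    rw [integral_neg, (integral_cosh_mul_besselK_integrand hx ν).2, ← neg_div] at h2
    exact h2
  · have := cosh_pos t
    have := cosh_pos (ν * t)
    rw [norm_neg, norm_of_nonneg (by positivity)]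
    gcongr
    exact (mem_Ioi.1 hy).le
  · have : HasDerivAt (fun y : ℝ => exp (-y * cosh t) * cosh (ν * t))
        (exp (-y * cosh t) * (-1 * cosh t) * cosh (ν * t)) y :=
      (((hasDerivAt_id y).neg.mul_const (cosh t)).exp).mul_const _
    exact this.congr_deriv (by ring)

/-- Integrate the derivative of `exp (-x cosh t) sinh (ν t)`, which vanishes at `0` and at infinity.
-/
theorem besselK_recurrence {x : ℝ} (hx : 0 < x) (ν : ℝ) :
    x * besselK (ν + 1) x = x * besselK (ν - 1) x + 2 * ν * besselK ν x := by
  have hd : ∀ t ∈ Ici (0 : ℝ), HasDerivAt (fun t => exp (-x * cosh t) * sinh (ν * t))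
      (ν * (exp (-x * cosh t) * cosh (ν * t)) + (-x / 2) * (exp (-x * cosh t) * cosh ((ν + 1) * t)
        - exp (-x * cosh t) * cosh ((ν - 1) * t))) t := by
    intro t _
    have h := (((hasDerivAt_cosh t).const_mul (-x)).exp).mul
      (((hasDerivAt_id t).const_mul ν).sinh)
    refine h.congr_deriv ?_
    rw [show (ν - 1) * t = ν * t - t by ring, show (ν + 1) * t = ν * t + t by ring, cosh_sub,
      cosh_add]
    simp only [id]
    ring
  have i0 := (integrableOn_besselK hx ν).const_mul ν
  have i1 := integrableOn_besselK hx (ν + 1)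
  have i2 := integrableOn_besselK hx (ν - 1)
  have ht : Tendsto (fun t => exp (-x * cosh t) * sinh (ν * t)) atTop (𝓝 0) := by
    have e : ∀ c : ℝ, Tendsto (fun t => exp (-x * cosh t + c * t)) atTop (𝓝 0) := by
      intro c
      have h0 : Tendsto (fun t : ℝ => exp ((c + 1) ^ 2 / x) * exp (-1 * t)) atTop (𝓝 0) := by
        have : Tendsto (fun t : ℝ => exp (-1 * t)) atTop (𝓝 0) := by
          simpa using tendsto_exp_neg_atTop_nhds_zero
        simpa using this.const_mul (exp ((c + 1) ^ 2 / x))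
      exact squeeze_zero (fun t => (exp_pos _).le) (exp_neg_mul_cosh_add_mul_le hx c) h0
    have := ((e ν).sub (e (-ν))).const_mul (1 / 2)
    simp only [sub_zero, mul_zero] at this
    refine this.congr fun t => ?_
    rw [sinh_eq (ν * t), exp_add, exp_add, neg_mul ν t]
    ring
  have h := integral_Ioi_of_hasDerivAt_of_tendsto' hd
    (i0.add ((i1.sub i2).const_mul (-x / 2))) ht
  have e1 := integral_add i0 ((i1.sub i2).const_mul (-x / 2))
  have e2 := integral_sub i1 i2
  rw [integral_const_mul, integral_const_mul] at e1
  simp only [Pi.sub_apply] at e1 e2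
  rw [e1, e2] at h
  simp only [mul_zero, sinh_zero, sub_self] at h
  change ν * besselK ν x + -x / 2 * (besselK (ν + 1) x - besselK (ν - 1) x) = 0 at h
  linarith

/-- The behaviour of `K_ν` at the origin, for positive order. -/
theorem tendsto_rpow_mul_besselK {ν : ℝ} (hν : 0 < ν) :
    Tendsto (fun y => y ^ ν * besselK ν y) (𝓝[>] 0) (𝓝 (2 ^ (ν - 1) * Gamma ν)) := by
  -- The substitution `v = (y/2) e^t` turns the `e^{νt}` half of `cosh (ν t)` into a truncated Gamma
  -- integral with the extra factor `exp (-y²/(4v))`; dominated convergence then applies.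
  have hpart : ∀ y : ℝ, 0 < y → y ^ ν * ∫ t in Ioi (0 : ℝ), exp (-y * cosh t + ν * t) =
      2 ^ ν * ∫ v in Ioi (0 : ℝ),
        (Ioi (y / 2)).indicator (fun v => exp (-v - y ^ 2 / (4 * v)) * v ^ (ν - 1)) v := by
    intro y hy
    have h1 := integral_comp_exp_Ioi
      (fun u : ℝ => exp (-(y / 2 * u) - y ^ 2 / (4 * (y / 2 * u))) * u ^ (ν - 1)) 0
    have h2 : ∀ t : ℝ, exp t • (exp (-(y / 2 * exp t) - y ^ 2 / (4 * (y / 2 * exp t)))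
        * exp t ^ (ν - 1)) = exp (-y * cosh t + ν * t) := by
      intro t
      have h3 : y ^ 2 / (4 * (y / 2 * exp t)) = y / 2 * exp (-t) := by
        rw [exp_neg]; field_simp; ring
      rw [h3, ← exp_mul, smul_eq_mul, ← exp_add, ← exp_add, cosh_eq]
      ring_nf
    simp_rw [h2] at h1
    rw [h1, exp_zero, setIntegral_indicator measurableSet_Ioi]
    have h4 : Ioi (0 : ℝ) ∩ Ioi (y / 2) = Ioi (y / 2) :=
      inter_eq_right.2 (Ioi_subset_Ioi (by positivity))
    rw [h4]
    have h5 := integral_comp_mul_left_Ioi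
      (fun v : ℝ => exp (-v - y ^ 2 / (4 * v)) * v ^ (ν - 1)) 1 (half_pos hy)
    rw [mul_one, smul_eq_mul] at h5
    have h6 : ∫ v in Ioi (y / 2), exp (-v - y ^ 2 / (4 * v)) * v ^ (ν - 1) =
        y / 2 * ∫ x in Ioi 1, exp (-(y / 2 * x) - y ^ 2 / (4 * (y / 2 * x)))
          * (y / 2 * x) ^ (ν - 1) := by
      rw [h5, mul_inv_cancel_left₀ (by positivity)]
    rw [h6]
    have h7 : ∫ x in Ioi 1, exp (-(y / 2 * x) - y ^ 2 / (4 * (y / 2 * x)))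
        * (y / 2 * x) ^ (ν - 1) = ∫ x in Ioi 1, (y / 2) ^ (ν - 1) *
          (exp (-(y / 2 * x) - y ^ 2 / (4 * (y / 2 * x))) * x ^ (ν - 1)) := by
      refine setIntegral_congr_fun measurableSet_Ioi fun x hx => ?_
      have : (0 : ℝ) ≤ x := zero_le_one.trans (mem_Ioi.1 hx).le
      rw [mul_rpow (by positivity) this]
      ring
    rw [h7, integral_const_mul, ← mul_assoc, ← mul_assoc]
    congr 1
    rw [rpow_sub_one (by positivity), div_rpow hy.le zero_le_two]
    field_simp
  have hlim1 : Tendsto (fun y : ℝ => ∫ v in Ioi (0 : ℝ),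
      (Ioi (y / 2)).indicator (fun v => exp (-v - y ^ 2 / (4 * v)) * v ^ (ν - 1)) v)
      (𝓝[>] 0) (𝓝 (Gamma ν)) := by
    rw [Gamma_eq_integral hν]
    refine tendsto_integral_filter_of_dominated_convergence
      (fun v => exp (-v) * v ^ (ν - 1)) ?_ ?_ (GammaIntegral_convergent hν) ?_
    · refine Eventually.of_forall fun y => ?_
      refine Measurable.aestronglyMeasurable ?_
      exact Measurable.indicator (by fun_prop) measurableSet_Ioi
    · refine Eventually.of_forall fun y => ?_
      filter_upwards [ae_restrict_mem measurableSet_Ioi] with v hv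
      have hv : 0 < v := hv
      refine (norm_indicator_le_norm_self _ _).trans ?_
      rw [norm_of_nonneg (by positivity)]
      gcongr
      have : 0 ≤ y ^ 2 / (4 * v) := by positivity
      linarith
    · filter_upwards [ae_restrict_mem measurableSet_Ioi] with v hv
      have hv : 0 < v := hv
      have h1 : Tendsto (fun y : ℝ => exp (-v - y ^ 2 / (4 * v)) * v ^ (ν - 1)) (𝓝[>] 0)
          (𝓝 (exp (-v) * v ^ (ν - 1))) := by
        have : Continuous fun y : ℝ => exp (-v - y ^ 2 / (4 * v)) * v ^ (ν - 1) := by fun_prop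
        have h2 := (this.tendsto 0).mono_left (nhdsWithin_le_nhds (s := Ioi 0))
        simpa using h2
      refine h1.congr' ?_
      have h3 : Iio (2 * v) ∈ 𝓝[>] (0 : ℝ) :=
        mem_nhdsWithin_of_mem_nhds (Iio_mem_nhds (by positivity))
      filter_upwards [h3] with y hy
      rw [indicator_of_mem]
      have : y < 2 * v := hy
      exact mem_Ioi.2 (by linarith)
  -- The `e^{-νt}` half is at most `1/ν`, so the factor `y^ν` removes it.
  have hlim2 : Tendsto (fun y : ℝ => y ^ ν * ∫ t in Ioi (0 : ℝ), exp (-y * cosh t + -ν * t))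
      (𝓝[>] 0) (𝓝 0) := by
    have h0 : Tendsto (fun y : ℝ => y ^ ν * (1 / ν)) (𝓝[>] 0) (𝓝 0) := by
      have : ContinuousAt (fun y : ℝ => y ^ ν * (1 / ν)) 0 :=
        (continuousAt_rpow_const _ _ (Or.inr hν.le)).mul continuousAt_const
      have h2 := this.tendsto.mono_left (nhdsWithin_le_nhds (s := Ioi 0))
      simpa [zero_rpow hν.ne'] using h2
    refine squeeze_zero' ?_ ?_ h0
    · filter_upwards [self_mem_nhdsWithin] with y hy
      have hy : 0 < y := hy
      have : 0 ≤ ∫ t in Ioi (0 : ℝ), exp (-y * cosh t + -ν * t) :=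
        integral_nonneg fun t => (exp_pos _).le
      positivity
    · filter_upwards [self_mem_nhdsWithin] with y hy
      have hy : 0 < y := hy
      gcongr
      have h1 : ∫ t in Ioi (0 : ℝ), exp (-ν * t) = 1 / ν := by
        rw [integral_exp_mul_Ioi (by linarith)]
        simp
      rw [← h1]
      refine setIntegral_mono_on (integrableOn_exp_neg_mul_cosh_add_mul hy _)
        (integrableOn_exp_mul_Ioi (by linarith) 0) measurableSet_Ioi fun t _ => ?_
      apply exp_le_exp.2
      have := mul_pos hy (cosh_pos t)
      linarith
  have h := ((hlim1.const_mul (2 ^ ν)).add hlim2).const_mul (1 / 2)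
  rw [add_zero, ← mul_assoc, show (1 : ℝ) / 2 * 2 ^ ν = 2 ^ (ν - 1) by
    rw [rpow_sub_one two_ne_zero]; ring] at h
  refine h.congr' ?_
  filter_upwards [self_mem_nhdsWithin] with y hy
  have hy : 0 < y := hy
  rw [← hpart y hy, ← mul_add, ← integral_add (integrableOn_exp_neg_mul_cosh_add_mul hy _)
    (integrableOn_exp_neg_mul_cosh_add_mul hy _), mul_left_comm, ← integral_const_mul]
  simp_rw [← exp_mul_cosh_eq]
  rfl

/-! ### The Bessel ratio: recurrence, reflection, Riccati equation, quadratic inequalities. -/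

/-- The ratio `y K_ν(y) / K_{ν-1}(y)`. -/
def besselRatio (ν y : ℝ) : ℝ := y * besselK ν y / besselK (ν - 1) y

theorem besselRatio_pos {y : ℝ} (hy : 0 < y) (ν : ℝ) : 0 < besselRatio ν y :=
  div_pos (mul_pos hy (besselK_pos hy _)) (besselK_pos hy _)

theorem besselRatio_recurrence {y : ℝ} (hy : 0 < y) (ν : ℝ) :
    besselRatio ν y * besselRatio (ν - 1) y = 2 * (ν - 1) * besselRatio (ν - 1) y + y ^ 2 := by
  have h := besselK_recurrence hy (ν - 1)
  have h1 := besselK_pos hy (ν - 1)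
  have h2 := besselK_pos hy (ν - 1 - 1)
  rw [sub_add_cancel] at h
  unfold besselRatio
  field_simp
  linarith

theorem besselRatio_mul_reflect {y : ℝ} (hy : 0 < y) (ν : ℝ) :
    besselRatio ν y * besselRatio (1 - ν) y = y ^ 2 := by
  have h1 := besselK_pos hy (ν - 1)
  have h2 := besselK_pos hy ν
  unfold besselRatio
  rw [show 1 - ν - 1 = -ν by ring, besselK_neg, show 1 - ν = -(ν - 1) by ring, besselK_neg]
  field_simp

/-- The Riccati equation, in which the recurrence has removed the orders `ν - 2` and `ν + 1`. -/
theorem hasDerivAt_besselRatio {y : ℝ} (hy : 0 < y) (ν : ℝ) :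
    HasDerivAt (besselRatio ν)
      ((besselRatio ν y ^ 2 - 2 * (ν - 1) * besselRatio ν y - y ^ 2) / y) y := by
  have h1 := besselK_pos hy (ν - 1)
  have hd := ((hasDerivAt_id y).mul (hasDerivAt_besselK hy ν)).div
    (hasDerivAt_besselK hy (ν - 1)) h1.ne'
  refine hd.congr_deriv ?_
  have r1 := besselK_recurrence hy (ν - 1)
  have r2 := besselK_recurrence hy ν
  rw [sub_add_cancel] at r1 ⊢
  have e1 : besselK (ν - 1 - 1) y = besselK ν y - 2 * (ν - 1) * besselK (ν - 1) y / y := by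
    field_simp; linarith
  have e2 : besselK (ν + 1) y = besselK (ν - 1) y + 2 * ν * besselK ν y / y := by
    field_simp; linarith
  rw [e1, e2]
  simp only [besselRatio, Pi.mul_apply, id]
  field_simp
  ring

theorem besselRatio_upper {y : ℝ} (hy : 0 < y) (ν : ℝ) :
    besselRatio ν y ^ 2 - 2 * ν * besselRatio ν y - y ^ 2 < 0 := by
  have h1 := besselK_pos hy (ν - 1)
  have r := besselK_recurrence hy ν
  have t := mul_lt_mul_of_pos_left (besselK_turan hy ν) hy
  rw [mul_left_comm y, r] at t
  have e : besselRatio ν y ^ 2 - 2 * ν * besselRatio ν y - y ^ 2 =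
      y * (y * besselK ν y ^ 2 - besselK (ν - 1) y * (y * besselK (ν - 1) y + 2 * ν * besselK ν y))
        / besselK (ν - 1) y ^ 2 := by
    unfold besselRatio
    field_simp
    ring
  rw [e]
  exact div_neg_of_neg_of_pos (mul_neg_of_pos_of_neg hy (by linarith)) (by positivity)

theorem besselRatio_lower {y : ℝ} (hy : 0 < y) (ν : ℝ) :
    0 < besselRatio ν y ^ 2 - 2 * (ν - 1) * besselRatio ν y - y ^ 2 := by
  have h1 := besselK_pos hy (ν - 1)
  have r := besselK_recurrence hy (ν - 1)
  have t := mul_lt_mul_of_pos_left (besselK_turan hy (ν - 1)) hy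
  rw [sub_add_cancel] at r t
  rw [← mul_assoc, show y * besselK (ν - 1 - 1) y =
    y * besselK ν y - 2 * (ν - 1) * besselK (ν - 1) y by linarith] at t
  have e : besselRatio ν y ^ 2 - 2 * (ν - 1) * besselRatio ν y - y ^ 2 =
      y * ((y * besselK ν y - 2 * (ν - 1) * besselK (ν - 1) y) * besselK ν y
        - y * besselK (ν - 1) y ^ 2) / besselK (ν - 1) y ^ 2 := by
    unfold besselRatio
    field_simp
  rw [e]
  exact div_pos (mul_pos hy (by linarith)) (by positivity)

theorem besselRatio_lt_add {y : ℝ} (hy : 0 < y) (ν : ℝ) : besselRatio ν y < y + 2 * |ν| := by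
  by_contra! h
  have := besselRatio_upper hy ν
  have h1 := abs_nonneg ν
  have h2 := le_abs_self ν
  have : (y + 2 * |ν|) * y ≤ besselRatio ν y * (besselRatio ν y - 2 * ν) :=
    mul_le_mul h (by linarith) hy.le (besselRatio_pos hy ν).le
  nlinarith

theorem sub_lt_besselRatio {y : ℝ} (hy : 0 < y) (ν : ℝ) : y - 2 * |ν - 1| < besselRatio ν y := by
  by_contra! h
  have := besselRatio_lower hy ν
  have h1 := abs_nonneg (ν - 1)
  have h2 := neg_abs_le (ν - 1)
  have hp := besselRatio_pos hy ν
  have : besselRatio ν y * (besselRatio ν y - 2 * (ν - 1)) ≤ y * y :=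
    mul_le_mul (by linarith) (by linarith) (by nlinarith) hy.le
  nlinarith

theorem lt_besselRatio {y : ℝ} (hy : 0 < y) {ν : ℝ} (hν : 1 / 2 < ν) : y < besselRatio ν y := by
  have h : |ν - 1| < |ν| := by
    rw [abs_of_pos (by linarith : 0 < ν), abs_lt]
    constructor <;> linarith
  unfold besselRatio
  rw [lt_div_iff₀ (besselK_pos hy _)]
  exact mul_lt_mul_of_pos_left (besselK_lt_of_abs_lt hy h) hy

theorem besselRatio_lt {y : ℝ} (hy : 0 < y) {ν : ℝ} (hν : ν < 1 / 2) : besselRatio ν y < y := by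
  have h := lt_besselRatio hy (by linarith : 1 / 2 < 1 - ν)
  have h1 := besselRatio_mul_reflect hy ν
  have h2 := besselRatio_pos hy ν
  nlinarith

theorem besselRatio_half {y : ℝ} (hy : 0 < y) : besselRatio (1 / 2) y = y := by
  unfold besselRatio
  rw [show (1 : ℝ) / 2 - 1 = -(1 / 2) by norm_num, besselK_neg,
    mul_div_cancel_right₀ _ (besselK_pos hy _).ne']

/-- A barrier principle: a function that decreases at each of its zeros cannot cross zero upwards.
It makes a wrong sign at one point persist to infinity, where asymptotics refute it. -/
theorem nonpos_of_deriv_neg_of_eq_zero {w w' : ℝ → ℝ} {a : ℝ}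
    (hd : ∀ y, a ≤ y → HasDerivAt w (w' y) y) (ha : w a ≤ 0)
    (hw : ∀ y, a ≤ y → w y = 0 → w' y < 0) {y : ℝ} (hy : a ≤ y) : w y ≤ 0 :=
  image_le_of_deriv_right_lt_deriv_boundary (B := fun _ => 0) (B' := fun _ => 0) (b := y)
    (fun x hx => (hd x hx.1).continuousAt.continuousWithinAt)
    (fun x hx => (hd x hx.1).hasDerivWithinAt) ha (fun x => hasDerivAt_const x 0)
    (fun x hx h => hw x hx.1 h) ⟨hy, le_rfl⟩

/-- The quadratic `E` is `z²` times the derivative of `H_ν(z)/z`, and by the Riccati equation `E' =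
(2ν-1) H_ν / z > 0` wherever `E = 0`. If `E(y) ≥ 0`, then `E` stays nonnegative and `H_ν(z)/z` is
nondecreasing from a value above `1`; but `H_ν(z) < z + 2|ν|` forces it down to `1`. -/
theorem besselRatio_middle_neg {y : ℝ} (hy : 0 < y) {ν : ℝ} (hν : 1 / 2 < ν) :
    besselRatio ν y ^ 2 - (2 * ν - 1) * besselRatio ν y - y ^ 2 < 0 := by
  by_contra! hcon
  set E : ℝ → ℝ := fun z => besselRatio ν z ^ 2 - (2 * ν - 1) * besselRatio ν z - z ^ 2 with hE
  have hdE : ∀ z, 0 < z → HasDerivAt E ((2 * besselRatio ν z - (2 * ν - 1)) *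
      ((besselRatio ν z ^ 2 - 2 * (ν - 1) * besselRatio ν z - z ^ 2) / z) - 2 * z) z := by
    intro z hz
    have h := hasDerivAt_besselRatio hz ν
    refine (((h.pow 2).sub (h.const_mul (2 * ν - 1))).sub (hasDerivAt_pow 2 z)).congr_deriv ?_
    simp
    ring
  have hE0 : ∀ z, y ≤ z → 0 ≤ E z := by
    intro z hz
    have := nonpos_of_deriv_neg_of_eq_zero (w := fun z => -E z) (a := y)
      (fun z hz => (hdE z (hy.trans_le hz)).neg) (neg_nonpos.2 hcon) ?_ hz
    · linarith
    · intro u hu h0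
      have hu0 := hy.trans_le hu
      have h1 : besselRatio ν u ^ 2 = (2 * ν - 1) * besselRatio ν u + u ^ 2 := by
        have : E u = 0 := neg_eq_zero.1 h0
        simp only [hE] at this
        linarith
      have h2 : (2 * besselRatio ν u - (2 * ν - 1)) *
          ((besselRatio ν u ^ 2 - 2 * (ν - 1) * besselRatio ν u - u ^ 2) / u) - 2 * u =
          (2 * ν - 1) * besselRatio ν u / u := by
        have h3 : besselRatio ν u ^ 2 - 2 * (ν - 1) * besselRatio ν u - u ^ 2 =
          besselRatio ν u := by linarith
        rw [h3]
        field_simp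
        linarith
      rw [h2]
      exact neg_neg_of_pos (div_pos (mul_pos (by linarith) (besselRatio_pos hu0 ν)) hu0)
  have hmono : MonotoneOn (fun z => besselRatio ν z / z) (Ici y) := by
    have hd : ∀ z, y ≤ z → HasDerivAt (fun z => besselRatio ν z / z) (E z / z ^ 2) z := by
      intro z hz
      have hz0 := hy.trans_le hz
      refine ((hasDerivAt_besselRatio hz0 ν).div (hasDerivAt_id z) hz0.ne').congr_deriv ?_
      simp only [hE, id]
      field_simp
      ring
    refine monotoneOn_of_hasDerivWithinAt_nonneg (f' := fun z => E z / z ^ 2) (convex_Ici y)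
      (fun z hz => (hd z hz).continuousAt.continuousWithinAt)
      (fun z hz => ?_) (fun z hz => ?_)
    · exact (hd z (interior_subset hz)).hasDerivWithinAt
    · exact div_nonneg (hE0 z (interior_subset hz)) (sq_nonneg z)
  have h1 : 1 < besselRatio ν y / y := (one_lt_div hy).2 (lt_besselRatio hy hν)
  set ε := besselRatio ν y / y - 1 with hε
  have hε0 : 0 < ε := by linarith
  -- Chosen so that `(1 + ε) z` exceeds `z + 2|ν|`.
  set z := y + 2 * |ν| / ε with hz
  have hyz : y ≤ z := by
    have : 0 ≤ 2 * |ν| / ε := by positivity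
    linarith
  have hz0 := hy.trans_le hyz
  have h2 : besselRatio ν y / y ≤ besselRatio ν z / z := hmono self_mem_Ici hyz hyz
  rw [le_div_iff₀ hz0] at h2
  have h3 := besselRatio_lt_add hz0 ν
  have h4 : ε * z = ε * y + 2 * |ν| := by
    rw [hz]; field_simp
  have h5 : besselRatio ν y / y = ε + 1 := by linarith
  rw [h5] at h2
  nlinarith [mul_pos hε0 hy]

/-- The reflection `H_ν H_{1-ν} = y²` exchanges the orders `ν` and `1 - ν` and reverses the sign of
the quadratic. -/
theorem besselRatio_middle_pos {y : ℝ} (hy : 0 < y) {ν : ℝ} (hν : ν < 1 / 2) :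
    0 < besselRatio ν y ^ 2 - (2 * ν - 1) * besselRatio ν y - y ^ 2 := by
  have h := besselRatio_middle_neg hy (by linarith : 1 / 2 < 1 - ν)
  have hr := besselRatio_mul_reflect hy ν
  have h1 := besselRatio_pos hy ν
  have h2 := besselRatio_pos hy (1 - ν)
  have e : (besselRatio ν y ^ 2 - (2 * ν - 1) * besselRatio ν y - y ^ 2) * besselRatio (1 - ν) y ^ 2
      = -(besselRatio (1 - ν) y ^ 2 - (2 * (1 - ν) - 1) * besselRatio (1 - ν) y - y ^ 2) * y ^ 2 := by
    linear_combination (besselRatio ν y * besselRatio (1 - ν) y + y ^ 2 -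
      (2 * ν - 1) * besselRatio (1 - ν) y) * hr
  refine pos_of_mul_pos_left (b := besselRatio (1 - ν) y ^ 2) ?_ (by positivity)
  rw [e]
  exact mul_pos (by linarith) (by positivity)

theorem besselRatio_middle_zero {y : ℝ} (hy : 0 < y) :
    besselRatio (1 / 2) y ^ 2 - (2 * (1 / 2) - 1) * besselRatio (1 / 2) y - y ^ 2 = 0 := by
  rw [besselRatio_half hy]
  ring

/-- Substituting `H_ν = 2(ν-1) + y²/H_{ν-1}` reduces the shifted quadratic at order `ν` to the
middle one at order `ν - 1`; the threshold `1/2` becomes `3/2`. -/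
theorem besselRatio_shifted_eq {y : ℝ} (hy : 0 < y) (ν : ℝ) :
    besselRatio ν y ^ 2 - (2 * ν - 1) * besselRatio ν y - y ^ 2 - (2 - 2 * ν) =
      -(besselRatio (ν - 1) y ^ 2 - (2 * (ν - 1) - 1) * besselRatio (ν - 1) y - y ^ 2) *
        (y ^ 2 / besselRatio (ν - 1) y ^ 2) := by
  have hr := besselRatio_recurrence hy ν
  have h2 := besselRatio_pos hy (ν - 1)
  have e : besselRatio ν y = 2 * (ν - 1) + y ^ 2 / besselRatio (ν - 1) y := by
    field_simp; linarith
  rw [e]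
  field_simp
  ring

theorem besselRatio_shifted_pos {y : ℝ} (hy : 0 < y) {ν : ℝ} (hν : 3 / 2 < ν) :
    0 < besselRatio ν y ^ 2 - (2 * ν - 1) * besselRatio ν y - y ^ 2 - (2 - 2 * ν) := by
  have h2 := besselRatio_pos hy (ν - 1)
  rw [besselRatio_shifted_eq hy]
  exact mul_pos (neg_pos.2 (besselRatio_middle_neg hy (by linarith))) (by positivity)

theorem besselRatio_shifted_neg {y : ℝ} (hy : 0 < y) {ν : ℝ} (hν : ν < 3 / 2) :
    besselRatio ν y ^ 2 - (2 * ν - 1) * besselRatio ν y - y ^ 2 - (2 - 2 * ν) < 0 := by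
  have h2 := besselRatio_pos hy (ν - 1)
  rw [besselRatio_shifted_eq hy]
  exact mul_neg_of_neg_of_pos (neg_neg_of_pos (besselRatio_middle_pos hy (by linarith)))
    (by positivity)

theorem besselRatio_shifted_zero {y : ℝ} (hy : 0 < y) :
    besselRatio (3 / 2) y ^ 2 - (2 * (3 / 2) - 1) * besselRatio (3 / 2) y - y ^ 2 - (2 - 2 * (3 / 2))
      = 0 := by
  rw [besselRatio_shifted_eq hy, show (3 : ℝ) / 2 - 1 = 1 / 2 by norm_num,
    besselRatio_middle_zero hy]
  ring

/-! ### Monotonicity of the ratio and the single crossing. -/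

theorem strictAntiOn_besselRatio_div {ν : ℝ} (hν : 1 / 2 < ν) :
    StrictAntiOn (fun z => besselRatio ν z / z) (Ioi 0) := by
  have hd : ∀ z, 0 < z → HasDerivAt (fun z => besselRatio ν z / z)
      ((besselRatio ν z ^ 2 - (2 * ν - 1) * besselRatio ν z - z ^ 2) / z ^ 2) z := by
    intro z hz0
    refine ((hasDerivAt_besselRatio hz0 ν).div (hasDerivAt_id z) hz0.ne').congr_deriv ?_
    simp only [id]
    field_simp
    ring
  refine strictAntiOn_of_deriv_neg (convex_Ioi 0)
    (fun z hz => (hd z hz).continuousAt.continuousWithinAt) fun z hz => ?_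
  have hz : 0 < z := interior_subset hz
  rw [(hd z hz).deriv]
  exact div_neg_of_neg_of_pos (besselRatio_middle_neg hz hν) (by positivity)

/-- The derivative of `D = z² - H²` is `2w/z`. At a zero of `w` one finds `w' = (z/H²)(2νH² - z²)`,
negative because `H < z`. So if `w` were negative somewhere it would stay nonpositive, and `D` would
be bounded above from there on. But the shifted inequality gives `D > (1-2ν)H - (2-2ν)`, which is
unbounded. -/
theorem monotoneOn_sq_sub_besselRatio_sq {ν : ℝ} (hν : ν < 1 / 2) :
    MonotoneOn (fun z => z ^ 2 - besselRatio ν z ^ 2) (Ioi 0) := by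
  set w : ℝ → ℝ := fun z => z ^ 2 - besselRatio ν z *
    (besselRatio ν z ^ 2 - 2 * (ν - 1) * besselRatio ν z - z ^ 2) with hw
  have hdD : ∀ z, 0 < z → HasDerivAt (fun z => z ^ 2 - besselRatio ν z ^ 2) (2 * w z / z) z := by
    intro z hz
    refine ((hasDerivAt_pow 2 z).sub ((hasDerivAt_besselRatio hz ν).pow 2)).congr_deriv ?_
    simp only [hw]
    field_simp
    simp
    ring
  have hw0 : ∀ y, 0 < y → 0 ≤ w y := by
    intro y hy
    by_contra! hcon
    have hneg : ∀ z, y ≤ z → w z ≤ 0 := by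
      intro z hz
      refine nonpos_of_deriv_neg_of_eq_zero (w' := fun z => 2 * z -
        ((besselRatio ν z ^ 2 - 2 * (ν - 1) * besselRatio ν z - z ^ 2) / z *
          (3 * besselRatio ν z ^ 2 - 4 * (ν - 1) * besselRatio ν z - z ^ 2)
          - 2 * z * besselRatio ν z)) (fun z hz => ?_) hcon.le (fun z hz h0 => ?_) hz
      · have h := hasDerivAt_besselRatio (hy.trans_le hz) ν
        refine ((hasDerivAt_pow 2 z).sub (h.mul (((h.pow 2).sub
          (h.const_mul (2 * (ν - 1)))).sub (hasDerivAt_pow 2 z)))).congr_deriv ?_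
        simp
        ring
      · have hz0 := hy.trans_le hz
        have hH := besselRatio_pos hz0 ν
        have hlt := besselRatio_lt hz0 hν
        simp only [hw] at h0
        set H := besselRatio ν z
        have hQ : H ^ 2 - 2 * (ν - 1) * H - z ^ 2 = z ^ 2 / H := by
          field_simp; linarith
        have hQ2 : 3 * H ^ 2 - 4 * (ν - 1) * H - z ^ 2 = H ^ 2 + 2 * (z ^ 2 / H) + z ^ 2 := by
          linarith
        have hQ3 : 2 * (ν - 1) * H = H ^ 2 - z ^ 2 - z ^ 2 / H := by linarith
        rw [hQ, hQ2]
        have e : 2 * z - (z ^ 2 / H / z * (H ^ 2 + 2 * (z ^ 2 / H) + z ^ 2) - 2 * z * H)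
          = (z / H ^ 2) * ((2 * H ^ 2 + H * (H ^ 2 - z ^ 2 - z ^ 2 / H)) - z ^ 2) := by
          field_simp
          ring
        rw [e, ← hQ3]
        refine mul_neg_of_pos_of_neg (by positivity) ?_
        nlinarith [mul_pos hH hH]
    have hanti : AntitoneOn (fun z => z ^ 2 - besselRatio ν z ^ 2) (Ici y) := by
      refine antitoneOn_of_hasDerivWithinAt_nonpos (f' := fun z => 2 * w z / z) (convex_Ici y)
        (fun z hz => (hdD z (hy.trans_le hz)).continuousAt.continuousWithinAt)
        (fun z hz => ?_) (fun z hz => ?_)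
      · exact (hdD z (hy.trans_le (interior_subset hz))).hasDerivWithinAt
      · have hz : y ≤ z := interior_subset hz
        exact div_nonpos_of_nonpos_of_nonneg (by linarith [hneg z hz]) (hy.trans_le hz).le
    set C := y ^ 2 - besselRatio ν y ^ 2
    -- Large enough that `H > z - 2|ν-1|` gives `(1-2ν)H - (2-2ν) > |C|`.
    set z := y + (|C| + (2 - 2 * ν)) / (1 - 2 * ν) + 2 * |ν - 1| with hz
    have h12 : 0 < 1 - 2 * ν := by linarith
    have hq : 0 ≤ (|C| + (2 - 2 * ν)) / (1 - 2 * ν) :=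
      div_nonneg (by have := abs_nonneg C; linarith) h12.le
    have hyz : y ≤ z := by
      have := abs_nonneg (ν - 1)
      linarith
    have hz0 := hy.trans_le hyz
    have h1 : z ^ 2 - besselRatio ν z ^ 2 ≤ C := hanti self_mem_Ici hyz hyz
    have h2 := besselRatio_shifted_neg hz0 (by linarith : ν < 3 / 2)
    have h3 := sub_lt_besselRatio hz0 ν
    have h4 : (|C| + (2 - 2 * ν)) / (1 - 2 * ν) < besselRatio ν z := by linarith
    rw [div_lt_iff₀ h12] at h4
    have h5 := le_abs_self C
    linarith
  refine monotoneOn_of_hasDerivWithinAt_nonneg (f' := fun z => 2 * w z / z) (convex_Ioi 0)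
    (fun z hz => (hdD z hz).continuousAt.continuousWithinAt)
    (fun z hz => (hdD z (interior_subset hz)).hasDerivWithinAt) (fun z hz => ?_)
  have hz : 0 < z := interior_subset hz
  exact div_nonneg (by linarith [hw0 z hz]) hz.le

/-- At most one crossing of `α² x` and `β H_ν(α √(δ² + x²))`, and it is from below. -/
theorem besselRatio_crossing {ν α β δ x₁ x₂ : ℝ} (hβ : 0 < β) (hβα : β < α)
    (h : 0 < δ ∨ 1 / 2 < ν) (hx₁ : 0 < x₁) (hx : x₁ < x₂)
    (hle : β * besselRatio ν (α * √(δ ^ 2 + x₁ ^ 2)) ≤ α ^ 2 * x₁) :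
    β * besselRatio ν (α * √(δ ^ 2 + x₂ ^ 2)) < α ^ 2 * x₂ := by
  have hα : 0 < α := hβ.trans hβα
  have hx₂ : 0 < x₂ := hx₁.trans hx
  have hsq : x₁ ^ 2 < x₂ ^ 2 := by gcongr
  set s₁ := √(δ ^ 2 + x₁ ^ 2) with hs₁
  set s₂ := √(δ ^ 2 + x₂ ^ 2) with hs₂
  have p₁ : 0 < s₁ := by positivity
  have p₂ : 0 < s₂ := by positivity
  have q₁ : s₁ ^ 2 = δ ^ 2 + x₁ ^ 2 := sq_sqrt (by positivity)
  have q₂ : s₂ ^ 2 = δ ^ 2 + x₂ ^ 2 := sq_sqrt (by positivity)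
  have hs : s₁ < s₂ := sqrt_lt_sqrt (by positivity) (by linarith)
  have y₁ : 0 < α * s₁ := by positivity
  have y₂ : 0 < α * s₂ := by positivity
  have hy : α * s₁ < α * s₂ := by gcongr
  have H₁ := besselRatio_pos y₁ ν
  have H₂ := besselRatio_pos y₂ ν
  -- For `ν < 1/2` compare squares: with `y = α√(δ²+x²)`, the difference `α⁴x² - β²H²` equals
  -- `(α²-β²)y² + β²(y²-H²) - α⁴δ²`, strictly increasing in `y`. For `ν ≥ 1/2`, `H/y` is
  -- nonincreasing and `x/√(δ²+x²)` nondecreasing; strictness comes from the first if `ν > 1/2` and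
  -- from the second if `δ > 0`.
  rcases lt_or_ge ν (1 / 2) with hν | hν
  · have hδ0 : 0 < δ := by rcases h with h | h; exacts [h, absurd h (by linarith)]
    have hm : (α * s₁) ^ 2 - besselRatio ν (α * s₁) ^ 2 ≤ (α * s₂) ^ 2 - besselRatio ν (α * s₂) ^ 2 :=
      monotoneOn_sq_sub_besselRatio_sq hν y₁ y₂ hy.le
    have h1 : (β * besselRatio ν (α * s₁)) ^ 2 ≤ (α ^ 2 * x₁) ^ 2 := by gcongr
    refine lt_of_pow_lt_pow_left₀ 2 (by positivity) ?_
    have hc : β ^ 2 < α ^ 2 := by gcongr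
    have e1 : (α ^ 2 * x₁) ^ 2 = α ^ 2 * ((α * s₁) ^ 2 - α ^ 2 * δ ^ 2) := by
      rw [mul_pow α s₁, q₁]; ring
    have e2 : (α ^ 2 * x₂) ^ 2 = α ^ 2 * ((α * s₂) ^ 2 - α ^ 2 * δ ^ 2) := by
      rw [mul_pow α s₂, q₂]; ring
    have hyy : (α * s₁) ^ 2 < (α * s₂) ^ 2 := by gcongr
    rw [e1] at h1
    rw [e2]
    nlinarith [mul_lt_mul_of_pos_left hyy (sub_pos.2 hc), mul_le_mul_of_nonneg_left hm (sq_nonneg β)]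
  · have hratio : besselRatio ν (α * s₂) / (α * s₂) ≤ besselRatio ν (α * s₁) / (α * s₁) := by
      rcases hν.lt_or_eq with hν | hν
      · exact (strictAntiOn_besselRatio_div hν y₁ y₂ hy).le
      · rw [← hν, besselRatio_half y₁, besselRatio_half y₂, div_self y₁.ne', div_self y₂.ne']
    rw [div_le_div_iff₀ y₂ y₁] at hratio
    have hxs : x₁ * s₂ ≤ x₂ * s₁ := by
      refine (pow_le_pow_iff_left₀ (by positivity) (by positivity) two_ne_zero).1 ?_
      rw [mul_pow, mul_pow, q₁, q₂]
      nlinarith [mul_le_mul_of_nonneg_left hsq.le (sq_nonneg δ)]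
    have hstrict : besselRatio ν (α * s₂) * (α * s₁) < besselRatio ν (α * s₁) * (α * s₂) ∨
        x₁ * s₂ < x₂ * s₁ := by
      rcases h with h | h
      · right
        refine lt_of_pow_lt_pow_left₀ 2 (by positivity) ?_
        rw [mul_pow, mul_pow, q₁, q₂]
        nlinarith [mul_lt_mul_of_pos_left hsq (by positivity : 0 < δ ^ 2)]
      · left
        have := strictAntiOn_besselRatio_div h y₁ y₂ hy
        rwa [div_lt_div_iff₀ y₂ y₁] at this
    refine lt_of_mul_lt_mul_right (a := s₁) ?_ p₁.le
    have a1 : β * besselRatio ν (α * s₂) * s₁ ≤ β * besselRatio ν (α * s₁) * s₂ := by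
      have : α * (besselRatio ν (α * s₂) * s₁) ≤ α * (besselRatio ν (α * s₁) * s₂) := by linarith
      have := le_of_mul_le_mul_left this hα
      nlinarith
    have a2 : β * besselRatio ν (α * s₁) * s₂ ≤ α ^ 2 * x₁ * s₂ := by gcongr
    have a3 : α ^ 2 * (x₁ * s₂) ≤ α ^ 2 * (x₂ * s₁) := by gcongr
    rcases hstrict with hstrict | hstrict
    · have : α * (besselRatio ν (α * s₂) * s₁) < α * (besselRatio ν (α * s₁) * s₂) := by linarith
      have := lt_of_mul_lt_mul_left this hα.le
      nlinarith
    · have : α ^ 2 * (x₁ * s₂) < α ^ 2 * (x₂ * s₁) := by gcongr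
      linarith

/-! ### Asymptotics of the ratio at the origin and at infinity. -/

theorem tendsto_besselRatio_of_one_lt {ν : ℝ} (hν : 1 < ν) :
    Tendsto (besselRatio ν) (𝓝[>] 0) (𝓝 (2 * (ν - 1))) := by
  have hν0 : 0 < ν - 1 := by linarith
  have hG := Gamma_pos_of_pos hν0
  have h := (tendsto_rpow_mul_besselK (by linarith : 0 < ν)).div (tendsto_rpow_mul_besselK hν0)
    (by positivity)
  have e : 2 ^ (ν - 1) * Gamma ν / (2 ^ (ν - 1 - 1) * Gamma (ν - 1)) = 2 * (ν - 1) := by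
    rw [show Gamma ν = (ν - 1) * Gamma (ν - 1) by rw [← Gamma_add_one hν0.ne', sub_add_cancel],
      rpow_sub_one two_ne_zero (ν - 1)]
    field_simp
  rw [e] at h
  refine h.congr' ?_
  filter_upwards [self_mem_nhdsWithin] with y hy
  have hy : 0 < y := hy
  have := besselK_pos hy (ν - 1)
  simp only [Pi.div_apply, besselRatio]
  rw [rpow_sub_one hy.ne']
  field_simp

theorem tendsto_besselRatio_div_rpow {ν : ℝ} (hν : 0 < ν) (hν1 : ν < 1) :
    Tendsto (fun y => besselRatio ν y / y ^ (2 - 2 * ν)) (𝓝[>] 0)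
      (𝓝 (2 ^ (2 * ν - 1) * Gamma ν / Gamma (1 - ν))) := by
  have hν0 : 0 < 1 - ν := by linarith
  have hG := Gamma_pos_of_pos hν0
  have h := (tendsto_rpow_mul_besselK hν).div (tendsto_rpow_mul_besselK hν0)
    (by positivity)
  have e : 2 ^ (ν - 1) * Gamma ν / (2 ^ (1 - ν - 1) * Gamma (1 - ν)) =
      2 ^ (2 * ν - 1) * Gamma ν / Gamma (1 - ν) := by
    rw [show (2 : ℝ) * ν - 1 = (ν - 1) - (1 - ν - 1) by ring, rpow_sub two_pos (ν - 1)]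
    field_simp
  rw [e] at h
  refine h.congr' ?_
  filter_upwards [self_mem_nhdsWithin] with y hy
  have hy : 0 < y := hy
  have := besselK_pos hy (1 - ν)
  have hp : y ^ (2 - 2 * ν) = y ^ (1 - ν) / y ^ ν * y := by
    rw [← rpow_sub hy, ← rpow_add_one hy.ne']
    ring_nf
  simp only [Pi.div_apply, besselRatio]
  rw [show ν - 1 = -(1 - ν) by ring, besselK_neg, hp]
  field_simp

theorem tendsto_besselRatio_div_sq {ν : ℝ} (hν : ν < 0) :
    Tendsto (fun y => besselRatio ν y / y ^ 2) (𝓝[>] 0) (𝓝 (1 / (-2 * ν))) := by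
  have h := (tendsto_besselRatio_of_one_lt (by linarith : 1 < 1 - ν)).inv₀
    (by intro h; linarith)
  rw [show (2 * (1 - ν - 1))⁻¹ = 1 / (-2 * ν) by rw [one_div]; ring_nf] at h
  refine h.congr' ?_
  filter_upwards [self_mem_nhdsWithin] with y hy
  have hy : 0 < y := hy
  have h1 := besselRatio_pos hy ν
  have h2 := besselRatio_pos hy (1 - ν)
  rw [← besselRatio_mul_reflect hy ν]
  field_simp

/-- Here `|ν - 1| ≤ 1/2`, so `K_{ν-1} ≤ K_{1/2}`. The ratio is thereby bounded below through
positive orders only, which also covers `ν = 1`, where the denominator is `K_0`. -/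
theorem besselK_half_div_le {y : ℝ} (hy : 0 < y) {ν : ℝ} (hν : 1 / 2 ≤ ν) (hν1 : ν ≤ 1) :
    y ^ ν * besselK ν y / (y ^ (1 / 2 : ℝ) * besselK (1 / 2) y) * y ^ (1 / 2 - ν) ≤
      besselRatio ν y / y := by
  have h1 := besselK_pos hy (1 / 2)
  have h2 := besselK_pos hy (ν - 1)
  have h3 := besselK_pos hy ν
  have e1 : y ^ ν * besselK ν y / (y ^ (1 / 2 : ℝ) * besselK (1 / 2) y) * y ^ (1 / 2 - ν) =
      besselK ν y / besselK (1 / 2) y := by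
    rw [rpow_sub hy]
    field_simp
  have e2 : besselRatio ν y / y = besselK ν y / besselK (ν - 1) y := by
    unfold besselRatio
    field_simp
  rw [e1, e2]
  refine div_le_div_of_nonneg_left h3.le h2 (besselK_le_of_abs_le hy ?_)
  rw [abs_le, abs_of_pos (by norm_num : (0 : ℝ) < 1 / 2)]
  constructor <;> linarith

theorem tendsto_besselK_half_div {ν : ℝ} (hν : 0 < ν) :
    ∃ c : ℝ, 0 < c ∧ Tendsto (fun y => y ^ ν * besselK ν y / (y ^ (1 / 2 : ℝ) * besselK (1 / 2) y))
      (𝓝[>] 0) (𝓝 c) := by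
  have h1 : 0 < Gamma (1 / 2 : ℝ) := Gamma_pos_of_pos (by norm_num)
  have h2 := Gamma_pos_of_pos hν
  exact ⟨_, by positivity, (tendsto_rpow_mul_besselK hν).div
    (tendsto_rpow_mul_besselK (by norm_num : (0 : ℝ) < 1 / 2)) (by positivity)⟩

theorem tendsto_besselRatio_div_atTop {ν : ℝ} (hν : 1 / 2 < ν) :
    Tendsto (fun y => besselRatio ν y / y) (𝓝[>] 0) atTop := by
  rcases le_or_gt ν 1 with hν1 | hν1
  · obtain ⟨c, hc, h⟩ := tendsto_besselK_half_div (by linarith : 0 < ν)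
    refine tendsto_atTop_mono' _ ?_ (h.pos_mul_atTop hc
      (tendsto_rpow_neg_nhdsGT_zero (by linarith : 1 / 2 - ν < 0)))
    filter_upwards [self_mem_nhdsWithin] with y hy using besselK_half_div_le hy hν.le hν1
  · simp_rw [div_eq_mul_inv]
    exact (tendsto_besselRatio_of_one_lt hν1).pos_mul_atTop (by linarith) tendsto_inv_nhdsGT_zero

/-- By the Riccati equation `φ = 1/H_1 + log y` has derivative `y/H_1²`. The crude bound `H_1² ≥
(c/2)² y` near `0` puts this derivative in `[0, C]`, so `φ` is bounded near `0`, and dividing by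
`-log y` gives the limit. -/
theorem tendsto_besselRatio_one_mul_log :
    Tendsto (fun y => besselRatio 1 y * -log y) (𝓝[>] 0) (𝓝 1) := by
  obtain ⟨c, hc, h⟩ := tendsto_besselK_half_div one_pos
  have hev : ∀ᶠ y in 𝓝[>] (0 : ℝ), (c / 2) ^ 2 * y ≤ besselRatio 1 y ^ 2 := by
    filter_upwards [self_mem_nhdsWithin, h.eventually (lt_mem_nhds (half_lt_self hc))] with y hy hlt
    have hy : 0 < y := hy
    have h1 := besselK_half_div_le hy (by norm_num : (1 : ℝ) / 2 ≤ 1) le_rfl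
    have h2 : c / 2 * y ^ (1 / 2 - 1 : ℝ) ≤ besselRatio 1 y / y :=
      (mul_le_mul_of_nonneg_right hlt.le (by positivity)).trans h1
    rw [le_div_iff₀ hy, mul_assoc, ← rpow_add_one hy.ne'] at h2
    have h3 : (c / 2 * y ^ (1 / 2 - 1 + 1 : ℝ)) ^ 2 ≤ besselRatio 1 y ^ 2 := by gcongr
    rwa [mul_pow, ← rpow_natCast (y ^ _), ← rpow_mul hy.le,
      show ((1 : ℝ) / 2 - 1 + 1) * (2 : ℕ) = 1 by norm_num, rpow_one] at h3
  obtain ⟨u, hu, hsub⟩ := (mem_nhdsGT_iff_exists_Ioo_subset).1 hev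
  have hu : 0 < u := hu
  set C := 1 / (c / 2) ^ 2 with hC
  set φ : ℝ → ℝ := fun y => 1 / besselRatio 1 y + log y with hφ
  have hd : ∀ y, 0 < y → HasDerivAt φ (y / besselRatio 1 y ^ 2) y := by
    intro y hy
    have h1 := besselRatio_pos hy 1
    have := (((hasDerivAt_const y (1 : ℝ)).div (hasDerivAt_besselRatio hy 1) h1.ne').add
      (hasDerivAt_log hy.ne'))
    refine this.congr_deriv ?_
    field_simp
    ring
  have hmono : MonotoneOn φ (Ioi 0) :=
    monotoneOn_of_hasDerivWithinAt_nonneg (f' := fun y => y / besselRatio 1 y ^ 2) (convex_Ioi 0)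
      (fun y hy => (hd y hy).continuousAt.continuousWithinAt)
      (fun y hy => (hd y (interior_subset hy)).hasDerivWithinAt)
      (fun y hy => by have : 0 < y := interior_subset hy; positivity)
  have hd2 : ∀ y, 0 < y → HasDerivAt (fun y => φ y - C * y) (y / besselRatio 1 y ^ 2 - C) y := by
    intro y hy
    exact ((hd y hy).sub ((hasDerivAt_id y).const_mul C)).congr_deriv (by simp)
  have hanti : AntitoneOn (fun y => φ y - C * y) (Ioo 0 u) :=
    antitoneOn_of_hasDerivWithinAt_nonpos (f' := fun y => y / besselRatio 1 y ^ 2 - C)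
      (convex_Ioo 0 u)
      (fun y hy => (hd2 y hy.1).continuousAt.continuousWithinAt)
      (fun y hy => (hd2 y (interior_subset hy).1).hasDerivWithinAt)
      (fun y hy => by
        have hy := interior_subset hy
        have h1 := besselRatio_pos hy.1 1
        have h2 : (c / 2) ^ 2 * y ≤ besselRatio 1 y ^ 2 := hsub hy
        rw [sub_nonpos, hC, div_le_div_iff₀ (by positivity) (by positivity)]
        linarith)
  have hhalf : u / 2 ∈ Ioo 0 u := ⟨half_pos hu, half_lt_self hu⟩
  have hlog : Tendsto (fun y => -log y) (𝓝[>] (0 : ℝ)) atTop :=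
    tendsto_neg_atBot_atTop.comp tendsto_log_nhdsGT_zero
  have hinv : Tendsto (fun y => (-log y)⁻¹) (𝓝[>] (0 : ℝ)) (𝓝 0) := tendsto_inv_atTop_zero.comp hlog
  have hlim : Tendsto (fun y => φ y * (-log y)⁻¹) (𝓝[>] (0 : ℝ)) (𝓝 0) := by
    refine bdd_le_mul_tendsto_zero' (|φ (u / 2)| + C * (u / 2)) ?_ hinv
    have : Ioo 0 (u / 2) ∈ 𝓝[>] (0 : ℝ) := Ioo_mem_nhdsGT (half_pos hu)
    filter_upwards [this] with y hy
    have h1 : φ y ≤ φ (u / 2) := hmono hy.1 hhalf.1 hy.2.le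
    have h2 : φ (u / 2) - C * (u / 2) ≤ φ y - C * y :=
      hanti ⟨hy.1, hy.2.trans hhalf.2⟩ hhalf hy.2.le
    have h3 : 0 ≤ C * y := by have := hy.1; positivity
    have h4 := le_abs_self (φ (u / 2))
    have h5 := neg_abs_le (φ (u / 2))
    have h6 : 0 ≤ C * (u / 2) := by positivity
    rw [abs_le]
    constructor <;> linarith
  have hfin := (hlim.add_const 1).inv₀ (by norm_num)
  rw [zero_add, inv_one] at hfin
  refine hfin.congr' ?_
  filter_upwards [self_mem_nhdsWithin, hlog.eventually (eventually_gt_atTop 0)] with y hy hl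
  have h1 := besselRatio_pos hy 1
  have h2 : log y ≠ 0 := by intro h; simp [h] at hl
  have e : φ y * (-log y)⁻¹ + 1 = (besselRatio 1 y * -log y)⁻¹ := by
    simp only [hφ]
    field_simp
    ring
  rw [e, inv_inv]

theorem tendsto_besselK_zero_atTop : Tendsto (besselK 0) (𝓝[>] 0) atTop := by
  have hlog : Tendsto (fun y => -log y) (𝓝[>] (0 : ℝ)) atTop :=
    tendsto_neg_atBot_atTop.comp tendsto_log_nhdsGT_zero
  have h := ((tendsto_rpow_mul_besselK one_pos).div tendsto_besselRatio_one_mul_log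
    one_ne_zero).pos_mul_atTop (by simp) hlog
  refine h.congr' ?_
  filter_upwards [self_mem_nhdsWithin, hlog.eventually (eventually_gt_atTop 0)] with y hy hl
  have hy : 0 < y := hy
  have h1 := besselK_pos hy 1
  have h3 := besselK_pos hy 0
  have h2 : log y ≠ 0 := by intro h; simp [h] at hl
  simp only [Pi.div_apply, besselRatio, sub_self, rpow_one]
  field_simp

theorem besselRatio_middle_le (ν : ℝ) : ∃ D : ℝ, 0 ≤ D ∧ ∀ y, 0 < y →
    besselRatio ν y ^ 2 - (2 * ν - 1) * besselRatio ν y - y ^ 2 ≤ D := by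
  rcases lt_or_ge (1 / 2) ν with hν | hν
  · exact ⟨0, le_rfl, fun y hy => (besselRatio_middle_neg hy hν).le⟩
  · refine ⟨2 - 2 * ν, by linarith, fun y hy => ?_⟩
    have := besselRatio_shifted_neg hy (by linarith : ν < 3 / 2)
    linarith

/-- The error `e = H_ν - y - (ν - 1/2)` satisfies `e (e + 2y) = E + (ν - 1/2)²` with `E` the middle
quadratic. `E` is bounded above directly, and below for large `y` through the identity linking it to
order `ν - 1`; hence `|e| ≤ B/y`. -/
theorem tendsto_besselRatio_sub (ν : ℝ) :
    Tendsto (fun y => besselRatio ν y - y) atTop (𝓝 (ν - 1 / 2)) := by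
  obtain ⟨D, hD, hup⟩ := besselRatio_middle_le ν
  obtain ⟨D', hD', hup'⟩ := besselRatio_middle_le (ν - 1)
  set B := D + 4 * D' + |2 - 2 * ν| + (ν - 1 / 2) ^ 2 with hB
  have key : Tendsto (fun y => besselRatio ν y - y - (ν - 1 / 2)) atTop (𝓝 0) := by
    have h0 : Tendsto (fun y : ℝ => B / y) atTop (𝓝 0) := tendsto_const_nhds.div_atTop tendsto_id
    refine squeeze_zero_norm' ?_ h0
    filter_upwards [eventually_gt_atTop (0 : ℝ), eventually_ge_atTop (4 * |ν - 1 - 1|),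
      eventually_ge_atTop (2 * |ν - 1| + |ν - 1 / 2|)] with y hy h1 h2
    rw [norm_eq_abs]
    set e := besselRatio ν y - y - (ν - 1 / 2) with he
    have h3 := sub_lt_besselRatio hy ν
    have h4 := le_abs_self (ν - 1 / 2)
    have h5 : y ≤ e + 2 * y := by linarith
    have hid : e * (e + 2 * y) = besselRatio ν y ^ 2 - (2 * ν - 1) * besselRatio ν y - y ^ 2
        + (ν - 1 / 2) ^ 2 := by
      rw [he]; ring
    have hu := hup y hy
    have hu' := hup' y hy
    have hsh := besselRatio_shifted_eq hy ν
    have hR := besselRatio_pos hy (ν - 1)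
    have hR2 : y / 2 ≤ besselRatio (ν - 1) y := by
      have := sub_lt_besselRatio hy (ν - 1)
      linarith
    have hq : y ^ 2 / besselRatio (ν - 1) y ^ 2 ≤ 4 := by
      rw [div_le_iff₀ (by positivity)]
      nlinarith
    have hq0 : 0 ≤ y ^ 2 / besselRatio (ν - 1) y ^ 2 := by positivity
    have hlow : -(4 * D') ≤ -(besselRatio (ν - 1) y ^ 2 - (2 * (ν - 1) - 1) * besselRatio (ν - 1) y
        - y ^ 2) * (y ^ 2 / besselRatio (ν - 1) y ^ 2) := by
      have a1 := mul_le_mul_of_nonneg_right hu' hq0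
      have a2 := mul_le_mul_of_nonneg_left hq hD'
      linarith
    have h6 := neg_abs_le (2 - 2 * ν)
    have h7 := abs_nonneg (2 - 2 * ν)
    have h8 := sq_nonneg (ν - 1 / 2)
    have habs : |e * (e + 2 * y)| ≤ B := by
      rw [abs_le]
      constructor <;> linarith
    rw [le_div_iff₀ hy]
    rw [abs_mul, abs_of_pos (by linarith : 0 < e + 2 * y)] at habs
    exact (mul_le_mul_of_nonneg_left h5 (abs_nonneg e)).trans habs
  simpa using key.add_const (ν - 1 / 2)

/-! ### The density, its derivative and its modes. -/

/-- The density of `GH(ν + 1/2, α, β, δ, 0)` up to a constant factor. -/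
def ghKernel (ν α β δ x : ℝ) : ℝ :=
  exp (β * x) * (√(δ ^ 2 + x ^ 2) ^ ν * besselK ν (α * √(δ ^ 2 + x ^ 2)))

theorem ghKernel_pos {ν α β δ x : ℝ} (hα : 0 < α) (h : 0 < δ ^ 2 + x ^ 2) :
    0 < ghKernel ν α β δ x := by
  have hs : 0 < √(δ ^ 2 + x ^ 2) := sqrt_pos.2 h
  have := besselK_pos (mul_pos hα hs) ν
  unfold ghKernel
  positivity

theorem hasDerivAt_rpow_mul_besselK {α s : ℝ} (hα : 0 < α) (hs : 0 < s) (ν : ℝ) :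
    HasDerivAt (fun s => s ^ ν * besselK ν (α * s)) (-(α * s ^ ν * besselK (ν - 1) (α * s))) s := by
  have hy : 0 < α * s := mul_pos hα hs
  have h1 := (hasDerivAt_id s).const_mul α
  have h2 := (hasDerivAt_besselK hy ν).comp s h1
  refine ((hasDerivAt_rpow_const (Or.inl hs.ne')).mul h2).congr_deriv ?_
  have r := besselK_recurrence hy ν
  have e : besselK (ν + 1) (α * s) = besselK (ν - 1) (α * s) + 2 * ν * besselK ν (α * s) / (α * s) := by
    field_simp; linarith
  simp only [Function.comp]
  rw [e, rpow_sub_one hs.ne']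
  field_simp
  ring

theorem hasDerivAt_ghKernel {ν α β δ x : ℝ} (hα : 0 < α) (h : 0 < δ ^ 2 + x ^ 2) :
    HasDerivAt (ghKernel ν α β δ)
      (exp (β * x) * √(δ ^ 2 + x ^ 2) ^ ν * besselK (ν - 1) (α * √(δ ^ 2 + x ^ 2))
        / (α * √(δ ^ 2 + x ^ 2)) * (β * besselRatio ν (α * √(δ ^ 2 + x ^ 2)) - α ^ 2 * x)) x := by
  have hs : 0 < √(δ ^ 2 + x ^ 2) := sqrt_pos.2 h
  have hd : HasDerivAt (fun x => √(δ ^ 2 + x ^ 2)) (x / √(δ ^ 2 + x ^ 2)) x := by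
    refine (((hasDerivAt_pow 2 x).const_add (δ ^ 2)).sqrt h.ne').congr_deriv ?_
    field_simp
    simp
  have h1 := ((hasDerivAt_id x).const_mul β).exp
  have h2 := (hasDerivAt_rpow_mul_besselK hα hs ν).comp x hd
  refine (h1.mul h2).congr_deriv ?_
  have := besselK_pos (mul_pos hα hs) (ν - 1)
  simp only [Function.comp, id, besselRatio]
  field_simp
  ring

theorem deriv_ghKernel_pos {ν α β δ x : ℝ} (hα : 0 < α) (h : 0 < δ ^ 2 + x ^ 2)
    (hg : α ^ 2 * x < β * besselRatio ν (α * √(δ ^ 2 + x ^ 2))) :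
    0 < deriv (ghKernel ν α β δ) x := by
  have hs : 0 < √(δ ^ 2 + x ^ 2) := sqrt_pos.2 h
  have := besselK_pos (mul_pos hα hs) (ν - 1)
  rw [(hasDerivAt_ghKernel hα h).deriv]
  exact mul_pos (by positivity) (sub_pos.2 hg)

theorem deriv_ghKernel_neg {ν α β δ x : ℝ} (hα : 0 < α) (h : 0 < δ ^ 2 + x ^ 2)
    (hg : β * besselRatio ν (α * √(δ ^ 2 + x ^ 2)) < α ^ 2 * x) :
    deriv (ghKernel ν α β δ) x < 0 := by
  have hs : 0 < √(δ ^ 2 + x ^ 2) := sqrt_pos.2 h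
  have := besselK_pos (mul_pos hα hs) (ν - 1)
  rw [(hasDerivAt_ghKernel hα h).deriv]
  exact mul_neg_of_pos_of_neg (by positivity) (sub_neg.2 hg)

theorem ghPDF_eq_const_mul_ghKernel {l α β δ : ℝ} (hβ : 0 < β) (hβα : β < α)
    (h : 0 < δ ∨ δ = 0 ∧ 0 < l) :
    ∃ c : ℝ, 0 < c ∧ ∀ x, 0 < δ ^ 2 + x ^ 2 → ghPDF l α β δ x = c * ghKernel (l - 1 / 2) α β δ x := by
  have hα : 0 < α := hβ.trans hβα
  have hγ : 0 < ghGamma α β := sqrt_pos.2 (by nlinarith)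
  rcases h with h | ⟨rfl, hl⟩
  · have hK := besselK_pos (mul_pos h hγ) l
    refine ⟨(ghGamma α β / δ) ^ l / (√(2 * π) * besselK l (δ * ghGamma α β)) / α ^ (l - 1 / 2),
      by positivity, fun x hx => ?_⟩
    have hs : 0 < √(δ ^ 2 + x ^ 2) := sqrt_pos.2 hx
    rw [ghPDF, if_neg h.ne', ghKernel, div_rpow hs.le hα.le,
      show (1 / 2 - l) = -(l - 1 / 2) by ring, rpow_neg hs.le, rpow_neg hα.le]
    field_simp
  · have hG := Gamma_pos_of_pos hl
    refine ⟨ghGamma α β ^ (2 * l) / (√π * Gamma l) / (2 * α) ^ (l - 1 / 2), by positivity,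
      fun x hx => ?_⟩
    rw [ghPDF, if_pos rfl, vgPDF, ghKernel, div_rpow (abs_nonneg x) (by positivity)]
    have : √((0 : ℝ) ^ 2 + x ^ 2) = |x| := by
      rw [← sqrt_sq_eq_abs]; simp
    rw [this]
    field_simp

/-- Continuous densities that agree almost everywhere are equal, so the density quantified in
`IsMode` must be `f`. -/
theorem isMode_iff_eq {μ : Measure ℝ} {f : ℝ → ℝ≥0∞} (hf : Continuous f)
    (hμ : μ = volume.withDensity f) {M : ℝ} (h : ∀ x, x ≠ M → f x < f M) (M' : ℝ) :
    IsMode μ M' ↔ M' = M := by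
  constructor
  · rintro ⟨g, hg, hμg, hmax⟩
    have hae : f =ᵐ[volume] g := (withDensity_eq_iff_of_sigmaFinite hf.measurable.aemeasurable
      hg.measurable.aemeasurable).1 (hμ.symm.trans hμg)
    have hfg : f = g := (Continuous.ae_eq_iff_eq volume hf hg).1 hae
    subst hfg
    by_contra hne
    exact (hmax M).not_gt (h M' hne)
  · rintro rfl
    refine ⟨f, hf, hμ, fun x => ?_⟩
    by_cases hx : x = M'
    · rw [hx]
    · exact (h x hx).le

theorem withDensity_congr_of_ne {f g : ℝ → ℝ≥0∞} {a : ℝ} (h : ∀ x, x ≠ a → f x = g x) :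
    (volume : Measure ℝ).withDensity f = volume.withDensity g := by
  refine withDensity_congr_ae ?_
  filter_upwards [Measure.ae_ne volume a] with x hx using h x hx

/-- The line is cut at `0` as well as at `M` because for `δ = 0` the density need not be
differentiable at the origin. -/
theorem lt_of_deriv_sign {F : ℝ → ℝ} (hF : Continuous F) {M : ℝ} (hM : 0 ≤ M)
    (h1 : ∀ x, x < 0 → 0 < deriv F x) (h2 : ∀ x, 0 < x → x < M → 0 < deriv F x)
    (h3 : ∀ x, M < x → deriv F x < 0) (x : ℝ) (hx : x ≠ M) : F x < F M := by
  have m1 : StrictMonoOn F (Iic 0) := strictMonoOn_of_deriv_pos (convex_Iic 0) hF.continuousOn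
    fun x hx => h1 x (by simpa using hx)
  have m2 : StrictMonoOn F (Icc 0 M) := strictMonoOn_of_deriv_pos (convex_Icc 0 M) hF.continuousOn
    fun x hx => by rw [interior_Icc] at hx; exact h2 x hx.1 hx.2
  have m3 : StrictAntiOn F (Ici M) := strictAntiOn_of_deriv_neg (convex_Ici M) hF.continuousOn
    fun x hx => h3 x (by simpa using hx)
  rcases lt_or_gt_of_ne hx with hx | hx
  · rcases lt_or_ge x 0 with h | h
    · exact (m1 h.le self_mem_Iic h).trans_le
        (m2.monotoneOn (left_mem_Icc.2 hM) (right_mem_Icc.2 hM) hM)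
    · exact m2 ⟨h, hx.le⟩ (right_mem_Icc.2 hM) hx
  · exact m3 self_mem_Ici hx.le hx

/-- A continuous function that is a positive multiple of the density off the origin, with a strict
maximum, determines the mode. -/
theorem isMode_iff_of_strict_max {l α β δ : ℝ} (hβ : 0 < β) (hβα : β < α)
    (h : 0 < δ ∨ δ = 0 ∧ 0 < l) {F : ℝ → ℝ} (hF : Continuous F)
    (hFk : ∀ x, x ≠ 0 → F x = ghKernel (l - 1 / 2) α β δ x) (hpos : ∀ x, 0 < F x) {M : ℝ}
    (hM : ∀ x, x ≠ M → F x < F M) (M' : ℝ) : IsMode (ghLaw l α β δ) M' ↔ M' = M := by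
  obtain ⟨c, hc, hck⟩ := ghPDF_eq_const_mul_ghKernel hβ hβα h
  refine isMode_iff_eq (f := fun x => ENNReal.ofReal (c * F x))
    (ENNReal.continuous_ofReal.comp (hF.const_mul c))
    (withDensity_congr_of_ne (a := 0) fun x hx => ?_) (fun x hx => ?_) M'
  · rw [hck x (by positivity), hFk x hx]
  · rw [ENNReal.ofReal_lt_ofReal_iff (mul_pos hc (hpos M))]
    exact mul_lt_mul_of_pos_left (hM x hx) hc

/-- The exponent `μ` is free so that `μ = ν` serves a finite limit at the origin (`ν > 0`) and `μ =
-ν` a pole (`ν ≤ 0`). -/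
theorem ghKernel_zero_eq {ν α β x : ℝ} (hα : 0 < α) (μ : ℝ) (hx : x ≠ 0) :
    ghKernel ν α β 0 x = exp (β * x) * (|x| ^ (ν - μ) * ((α * |x|) ^ μ * besselK ν (α * |x|)) / α ^ μ) := by
  have hx' : 0 < |x| := abs_pos.2 hx
  have : √((0 : ℝ) ^ 2 + x ^ 2) = |x| := by
    rw [← sqrt_sq_eq_abs]; simp
  rw [ghKernel, this, mul_rpow hα.le hx'.le, rpow_sub hx']
  field_simp

theorem tendsto_mul_abs_nhdsNE {α : ℝ} (hα : 0 < α) :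
    Tendsto (fun x : ℝ => α * |x|) (𝓝[≠] 0) (𝓝[>] 0) := by
  refine tendsto_nhdsWithin_iff.2 ⟨?_, ?_⟩
  · have : Continuous fun x : ℝ => α * |x| := by fun_prop
    simpa using (this.tendsto 0).mono_left (nhdsWithin_le_nhds (s := {0}ᶜ))
  · filter_upwards [self_mem_nhdsWithin] with x hx
    exact mul_pos hα (abs_pos.2 hx)

theorem tendsto_exp_mul_nhdsNE (β : ℝ) : Tendsto (fun x : ℝ => exp (β * x)) (𝓝[≠] 0) (𝓝 1) := by
  have : Continuous fun x : ℝ => exp (β * x) := by fun_prop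
  simpa using (this.tendsto 0).mono_left (nhdsWithin_le_nhds (s := {0}ᶜ))

theorem tendsto_ghKernel_zero {ν α : ℝ} (β : ℝ) (hα : 0 < α) (hν : 0 < ν) :
    Tendsto (ghKernel ν α β 0) (𝓝[≠] 0) (𝓝 (2 ^ (ν - 1) * Gamma ν / α ^ ν)) := by
  have h := (tendsto_exp_mul_nhdsNE β).mul
    (((tendsto_rpow_mul_besselK hν).comp (tendsto_mul_abs_nhdsNE hα)).div_const (α ^ ν))
  rw [one_mul] at h
  refine h.congr' ?_
  filter_upwards [self_mem_nhdsWithin] with x hx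
  rw [ghKernel_zero_eq hα ν hx]
  simp

theorem tendsto_ghKernel_zero_atTop {ν α : ℝ} (β : ℝ) (hα : 0 < α) (hν : ν ≤ 0) :
    Tendsto (ghKernel ν α β 0) (𝓝[≠] 0) atTop := by
  have hsuff : Tendsto (fun x : ℝ => |x| ^ (ν - -ν) * ((α * |x|) ^ (-ν) * besselK ν (α * |x|))
      / α ^ (-ν)) (𝓝[≠] 0) atTop := by
    refine Tendsto.atTop_div_const (by positivity) ?_
    rcases hν.lt_or_eq with hν | rfl
    · have h := (tendsto_rpow_mul_besselK (neg_pos.2 hν)).comp (tendsto_mul_abs_nhdsNE hα)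
      simp_rw [besselK_neg] at h
      have hG := Gamma_pos_of_pos (neg_pos.2 hν)
      exact Tendsto.atTop_mul_pos (by positivity) ((tendsto_rpow_neg_nhdsGT_zero
        (by linarith : ν - -ν < 0)).comp tendsto_abs_nhdsNE_zero) h
    · simpa using! tendsto_besselK_zero_atTop.comp (tendsto_mul_abs_nhdsNE hα)
  refine ((tendsto_exp_mul_nhdsNE β).pos_mul_atTop one_pos hsuff).congr' ?_
  filter_upwards [self_mem_nhdsWithin] with x hx
  rw [ghKernel_zero_eq hα (-ν) hx]

theorem continuousAt_ghKernel {ν α β δ x : ℝ} (hα : 0 < α) (h : 0 < δ ^ 2 + x ^ 2) :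
    ContinuousAt (ghKernel ν α β δ) x := (hasDerivAt_ghKernel hα h).continuousAt

theorem continuous_update_ghKernel {ν α : ℝ} (β : ℝ) (hα : 0 < α) (hν : 0 < ν) :
    Continuous (Function.update (ghKernel ν α β 0) 0 (2 ^ (ν - 1) * Gamma ν / α ^ ν)) := by
  rw [continuous_iff_continuousAt]
  intro x
  by_cases hx : x = 0
  · subst hx
    exact continuousAt_update_same.2 (tendsto_ghKernel_zero β hα hν)
  · exact (continuousAt_update_of_ne hx).2 (continuousAt_ghKernel hα (by positivity))

theorem deriv_update_of_ne {f : ℝ → ℝ} {a b x : ℝ} (hx : x ≠ a) :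
    deriv (Function.update f a b) x = deriv f x :=
  Filter.EventuallyEq.deriv_eq (by
    filter_upwards [isOpen_ne.mem_nhds hx] with z hz using Function.update_of_ne hz _ _)

/-- The mode is `M` if the critical point equation changes sign at `M`. -/
theorem isMode_iff_of_sign {l α β δ : ℝ} (hβ : 0 < β) (hβα : β < α) (h : 0 < δ ∨ δ = 0 ∧ 1 / 2 < l)
    {M : ℝ} (hM : 0 ≤ M)
    (h1 : ∀ x, 0 < x → x < M → α ^ 2 * x < β * besselRatio (l - 1 / 2) (α * √(δ ^ 2 + x ^ 2)))
    (h2 : ∀ x, M < x → β * besselRatio (l - 1 / 2) (α * √(δ ^ 2 + x ^ 2)) < α ^ 2 * x) (M' : ℝ) :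
    IsMode (ghLaw l α β δ) M' ↔ M' = M := by
  have hα : 0 < α := hβ.trans hβα
  have d1 : ∀ x, x < 0 → 0 < deriv (ghKernel (l - 1 / 2) α β δ) x := by
    intro x hx
    have hp : 0 < δ ^ 2 + x ^ 2 := by have := hx.ne; positivity
    have := besselRatio_pos (mul_pos hα (sqrt_pos.2 hp)) (l - 1 / 2)
    exact deriv_ghKernel_pos hα hp
      ((mul_neg_of_pos_of_neg (by positivity) hx).trans (mul_pos hβ this))
  have d2 : ∀ x, 0 < x → x < M → 0 < deriv (ghKernel (l - 1 / 2) α β δ) x := fun x hx hxM =>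
    deriv_ghKernel_pos hα (by positivity) (h1 x hx hxM)
  have d3 : ∀ x, M < x → deriv (ghKernel (l - 1 / 2) α β δ) x < 0 := fun x hx =>
    deriv_ghKernel_neg hα (by have := hM.trans_lt hx; positivity) (h2 x hx)
  rcases h with h | ⟨rfl, hl⟩
  · have hF : Continuous (ghKernel (l - 1 / 2) α β δ) :=
      continuous_iff_continuousAt.2 fun x => continuousAt_ghKernel hα (by positivity)
    exact isMode_iff_of_strict_max hβ hβα (Or.inl h) hF (fun _ _ => rfl)
      (fun x => ghKernel_pos hα (by positivity)) (lt_of_deriv_sign hF hM d1 d2 d3) M'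
  · have hν : 0 < l - 1 / 2 := by linarith
    have hF := continuous_update_ghKernel β hα hν
    have hG := Gamma_pos_of_pos hν
    refine isMode_iff_of_strict_max hβ hβα (Or.inr ⟨rfl, by linarith⟩) hF
      (fun x hx => Function.update_of_ne hx _ _) (fun x => ?_)
      (lt_of_deriv_sign hF hM (fun x hx => ?_) (fun x hx hxM => ?_) (fun x hx => ?_)) M'
    · by_cases hx : x = 0
      · rw [hx, Function.update_self]
        positivity
      · rw [Function.update_of_ne hx]
        exact ghKernel_pos hα (by positivity)
    · rw [deriv_update_of_ne hx.ne]
      exact d1 x hx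
    · rw [deriv_update_of_ne hx.ne']
      exact d2 x hx hxM
    · rw [deriv_update_of_ne (hM.trans_lt hx).ne']
      exact d3 x hx

/-! ### Solving the critical point equation. -/

theorem exists_besselRatio_gt {ν α β δ : ℝ} (hβ : 0 < β) (hβα : β < α)
    (h : 0 < δ ∨ δ = 0 ∧ 1 / 2 < ν) :
    ∃ x, 0 < x ∧ α ^ 2 * x < β * besselRatio ν (α * √(δ ^ 2 + x ^ 2)) := by
  have hα : 0 < α := hβ.trans hβα
  rcases h with h | ⟨rfl, hν⟩
  · have hc : ContinuousAt (fun x => β * besselRatio ν (α * √(δ ^ 2 + x ^ 2)) - α ^ 2 * x) 0 := by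
      have : ContinuousAt (besselRatio ν) (α * √(δ ^ 2 + 0 ^ 2)) :=
        (hasDerivAt_besselRatio (by positivity) ν).continuousAt
      refine ((ContinuousAt.comp (f := fun x => α * √(δ ^ 2 + x ^ 2)) this
        (by fun_prop)).const_mul β).sub (by fun_prop)
    have h0 : 0 < β * besselRatio ν (α * √(δ ^ 2 + 0 ^ 2)) - α ^ 2 * 0 := by
      have := besselRatio_pos (by positivity : 0 < α * √(δ ^ 2 + 0 ^ 2)) ν
      rw [mul_zero, sub_zero]
      positivity
    obtain ⟨x, hx, hx0⟩ := (((hc.eventually (lt_mem_nhds h0)).filter_mono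
      (nhdsWithin_le_nhds (s := Ioi 0))).and self_mem_nhdsWithin).exists
    exact ⟨x, hx0, sub_pos.1 hx⟩
  · obtain ⟨y, hy, hy0⟩ := (((tendsto_besselRatio_div_atTop hν).eventually
      (eventually_gt_atTop (α / β))).and self_mem_nhdsWithin).exists
    have hy0 : 0 < y := hy0
    refine ⟨y / α, by positivity, ?_⟩
    have : α * √(0 ^ 2 + (y / α) ^ 2) = y := by
      rw [zero_pow two_ne_zero, zero_add, sqrt_sq (by positivity)]
      field_simp
    rw [this]
    rw [div_lt_div_iff₀ hβ hy0] at hy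
    have : α ^ 2 * (y / α) = α * y := by field_simp
    linarith

theorem exists_eq_besselRatio {ν α β δ : ℝ} (hβ : 0 < β) (hβα : β < α)
    (h : 0 < δ ∨ δ = 0 ∧ 1 / 2 < ν) :
    ∃ M, 0 < M ∧ α ^ 2 * M = β * besselRatio ν (α * √(δ ^ 2 + M ^ 2)) := by
  have hα : 0 < α := hβ.trans hβα
  have hδ : 0 ≤ δ := by rcases h with h | ⟨rfl, -⟩ <;> [exact h.le; exact le_rfl]
  obtain ⟨a, ha, hag⟩ := exists_besselRatio_gt hβ hβα h
  -- From `H_ν(y) < y + 2|ν|` and `√(δ²+b²) ≤ δ + b` it suffices that `α(α-β) b ≥ β(αδ + 2|ν|)`.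
  set b := a + β * (α * δ + 2 * |ν|) / (α * (α - β)) with hb
  have hαβ : 0 < α - β := sub_pos.2 hβα
  have hab : a ≤ b := by
    have : 0 ≤ β * (α * δ + 2 * |ν|) / (α * (α - β)) := by positivity
    linarith
  have hb0 : 0 < b := ha.trans_le hab
  have hbg : β * besselRatio ν (α * √(δ ^ 2 + b ^ 2)) ≤ α ^ 2 * b := by
    have hs : 0 < √(δ ^ 2 + b ^ 2) := by positivity
    have h1 := besselRatio_lt_add (mul_pos hα hs) ν
    have h2 : √(δ ^ 2 + b ^ 2) ≤ δ + b := by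
      rw [sqrt_le_left (by positivity)]
      nlinarith [mul_nonneg hδ hb0.le]
    have h3 : α * (α - β) * b = α * (α - β) * a + β * (α * δ + 2 * |ν|) := by
      rw [hb]; field_simp
    have h4 : 0 < α * (α - β) * a := by positivity
    have h5 : β * besselRatio ν (α * √(δ ^ 2 + b ^ 2)) ≤ β * (α * (δ + b) + 2 * |ν|) := by
      gcongr
      exact h1.le.trans (by gcongr)
    nlinarith
  have hcont : ContinuousOn (fun x => α ^ 2 * x - β * besselRatio ν (α * √(δ ^ 2 + x ^ 2)))
      (Icc a b) := by
    intro x hx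
    have hx0 : 0 < x := ha.trans_le hx.1
    have : ContinuousAt (besselRatio ν) (α * √(δ ^ 2 + x ^ 2)) :=
      (hasDerivAt_besselRatio (by positivity) ν).continuousAt
    exact (ContinuousAt.sub (by fun_prop) ((ContinuousAt.comp (f := fun x => α * √(δ ^ 2 + x ^ 2))
      this (by fun_prop)).const_mul β)).continuousWithinAt
  obtain ⟨M, hM, hM0⟩ := intermediate_value_Icc hab hcont
    (show (0 : ℝ) ∈ Icc _ _ from ⟨by linarith, by linarith⟩)
  exact ⟨M, ha.trans_le hM.1, sub_eq_zero.1 hM0⟩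

/-- The mode is the only positive solution of the critical point equation. -/
theorem exists_isMode_iff {l α β δ : ℝ} (hβ : 0 < β) (hβα : β < α) (h : 0 < δ ∨ δ = 0 ∧ 1 < l) :
    ∃ M, 0 < M ∧ α ^ 2 * M = β * besselRatio (l - 1 / 2) (α * √(δ ^ 2 + M ^ 2)) ∧
      ∀ M', IsMode (ghLaw l α β δ) M' ↔ M' = M := by
  have h' : 0 < δ ∨ 1 / 2 < l - 1 / 2 := h.imp id fun h => by linarith [h.2]
  obtain ⟨M, hM, hMe⟩ := exists_eq_besselRatio (ν := l - 1 / 2) hβ hβα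
    (h.imp id fun h => ⟨h.1, by linarith [h.2]⟩)
  refine ⟨M, hM, hMe, isMode_iff_of_sign hβ hβα (h.imp id fun h => ⟨h.1, by linarith [h.2]⟩) hM.le
    (fun x hx hxM => ?_) (fun x hx => ?_)⟩
  · by_contra! hcon
    exact (besselRatio_crossing hβ hβα h' hx hxM hcon).ne hMe.symm
  · exact besselRatio_crossing hβ hβα h' hM hx hMe.ge

/-- For `1/2 < l ≤ 1` the order `l - 1/2` is at most `1/2`, so `H(y) ≤ y` and `β < α` make the
density decrease on `x > 0`. For `l ≤ 1/2` it has a pole at `0`. -/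
theorem isMode_iff_eq_zero {l α β : ℝ} (hβ : 0 < β) (hβα : β < α) (hl : 0 < l) (hl1 : l ≤ 1)
    (M' : ℝ) : IsMode (ghLaw l α β 0) M' ↔ M' = 0 := by
  have hα : 0 < α := hβ.trans hβα
  rcases lt_or_ge (1 / 2) l with h | h
  · refine isMode_iff_of_sign hβ hβα (Or.inr ⟨rfl, h⟩) le_rfl
      (fun x hx hx' => absurd hx hx'.not_gt) (fun x hx => ?_) M'
    have hs : √(0 ^ 2 + x ^ 2) = x := by
      rw [zero_pow two_ne_zero, zero_add, sqrt_sq hx.le]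
    have hy : 0 < α * x := mul_pos hα hx
    have hle : besselRatio (l - 1 / 2) (α * x) ≤ α * x := by
      rcases hl1.lt_or_eq with hl1 | rfl
      · exact (besselRatio_lt hy (by linarith)).le
      · rw [show (1 : ℝ) - 1 / 2 = 1 / 2 by norm_num, besselRatio_half hy]
    rw [hs]
    calc β * besselRatio (l - 1 / 2) (α * x) ≤ β * (α * x) := by gcongr
      _ < α * (α * x) := by gcongr
      _ = α ^ 2 * x := by ring
  · obtain ⟨c, hc, hck⟩ := ghPDF_eq_const_mul_ghKernel hβ hβα (δ := 0) (Or.inr ⟨rfl, hl⟩)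
    have hcont : Continuous (Function.update
        (fun x => ENNReal.ofReal (c * ghKernel (l - 1 / 2) α β 0 x)) 0 ∞) := by
      rw [continuous_iff_continuousAt]
      intro x
      by_cases hx : x = 0
      · subst hx
        exact continuousAt_update_same.2 (ENNReal.tendsto_ofReal_atTop.comp
          ((tendsto_ghKernel_zero_atTop β hα (by linarith)).const_mul_atTop hc))
      · exact (continuousAt_update_of_ne hx).2 (ENNReal.continuous_ofReal.continuousAt.comp
          ((continuousAt_ghKernel hα (by positivity)).const_mul c))
    refine isMode_iff_eq hcont (withDensity_congr_of_ne (a := 0) fun x hx => ?_)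
      (fun x hx => ?_) M'
    · rw [Function.update_of_ne hx, hck x (by positivity)]
    · rw [Function.update_of_ne hx, Function.update_self]
      exact ENNReal.ofReal_lt_top

/-! ### From quadratic inequalities to bounds for the mode. -/

theorem lt_add_sqrt_of_quadratic_neg {r c e : ℝ} (h : r ^ 2 - 2 * c * r - e < 0) :
    r < c + √(c ^ 2 + e) := by
  have : r - c < √(c ^ 2 + e) := lt_sqrt_of_sq_lt (by linarith)
  linarith

theorem add_sqrt_lt_of_quadratic_pos {r c e : ℝ} (h : 0 < r ^ 2 - 2 * c * r - e) (hc : c < r) :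
    c + √(c ^ 2 + e) < r := by
  have : √(c ^ 2 + e) < r - c := (sqrt_lt' (by linarith)).2 (by linarith)
  linarith

theorem eq_add_sqrt_of_quadratic_eq_zero {r c e : ℝ} (h : r ^ 2 - 2 * c * r - e = 0) (hc : c ≤ r) :
    r = c + √(c ^ 2 + e) := by
  have : √(c ^ 2 + e) = r - c := by
    rw [show c ^ 2 + e = (r - c) ^ 2 by linarith, sqrt_sq (by linarith)]
  linarith

/-- This places `r` on the side of the larger root, as the lower bounds need. -/
theorem lt_of_quadratic_nonneg {r c e : ℝ} (hr : 0 < r) (he : 0 ≤ e)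
    (h : 0 ≤ r ^ 2 - 2 * c * r - e) : c < r := by
  have : 0 ≤ r * (r - 2 * c) := by linarith
  have := nonneg_of_mul_nonneg_right this hr
  linarith

theorem ghGamma_sq {α β : ℝ} (hβ : 0 < β) (hβα : β < α) : ghGamma α β ^ 2 = α ^ 2 - β ^ 2 :=
  sq_sqrt (by nlinarith)

theorem ghGamma_pos {α β : ℝ} (hβ : 0 < β) (hβα : β < α) : 0 < ghGamma α β :=
  sqrt_pos.2 (by nlinarith)

section Bounds

variable {l α β δ M : ℝ}

/-- The quadratic whose roots give the bounds for the mode, in terms of the Bessel ratio. -/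
theorem quadratic_mode_eq {H : ℝ} (hβ : 0 < β) (hβα : β < α) (hE : α ^ 2 * M = β * H) (c k : ℝ) :
    (ghGamma α β ^ 2 * M / β) ^ 2 - 2 * c * (ghGamma α β ^ 2 * M / β)
        - ghGamma α β ^ 2 * (δ ^ 2 + k / α ^ 2) =
      ghGamma α β ^ 2 / α ^ 2 * (H ^ 2 - 2 * c * H - (α * √(δ ^ 2 + M ^ 2)) ^ 2 - k) := by
  have hα : 0 < α := hβ.trans hβα
  have hH : H = α ^ 2 * M / β := by field_simp; linarith
  rw [hH, mul_pow α, sq_sqrt (by positivity), ghGamma_sq hβ hβα]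
  field_simp
  ring

theorem modeBound_lt_of_pos (hβ : 0 < β) (hβα : β < α) (hM : 0 < M) {H : ℝ}
    (hE : α ^ 2 * M = β * H) {a : ℝ}
    (h : 0 < H ^ 2 - 2 * (l - a) * H - (α * √(δ ^ 2 + M ^ 2)) ^ 2) : modeBound a l α β δ < M := by
  have hα : 0 < α := hβ.trans hβα
  have hγ := ghGamma_pos hβ hβα
  have hq := quadratic_mode_eq (δ := δ) hβ hβα hE (l - a) 0
  simp only [zero_div, add_zero, sub_zero] at hq
  have h1 : 0 < (ghGamma α β ^ 2 * M / β) ^ 2 - 2 * (l - a) * (ghGamma α β ^ 2 * M / β)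
      - ghGamma α β ^ 2 * δ ^ 2 := hq ▸ mul_pos (by positivity) h
  have h2 := add_sqrt_lt_of_quadratic_pos h1
    (lt_of_quadratic_nonneg (by positivity) (by positivity) h1.le)
  have h3 : M = β / ghGamma α β ^ 2 * (ghGamma α β ^ 2 * M / β) := by field_simp
  rw [modeBound, h3, mul_comm (δ ^ 2)]
  gcongr

theorem lt_modeBound_of_neg (hβ : 0 < β) (hβα : β < α) {H : ℝ}
    (hE : α ^ 2 * M = β * H) {a : ℝ}
    (h : H ^ 2 - 2 * (l - a) * H - (α * √(δ ^ 2 + M ^ 2)) ^ 2 < 0) : M < modeBound a l α β δ := by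
  have hα : 0 < α := hβ.trans hβα
  have hγ := ghGamma_pos hβ hβα
  have hq := quadratic_mode_eq (δ := δ) hβ hβα hE (l - a) 0
  simp only [zero_div, add_zero, sub_zero] at hq
  have h2 := lt_add_sqrt_of_quadratic_neg (hq.trans_lt (mul_neg_of_pos_of_neg (by positivity) h))
  have h3 : M = β / ghGamma α β ^ 2 * (ghGamma α β ^ 2 * M / β) := by field_simp
  rw [modeBound, h3, mul_comm (δ ^ 2)]
  gcongr

theorem eq_modeBound_of_zero (hβ : 0 < β) (hβα : β < α) (hM : 0 < M) {H : ℝ}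
    (hE : α ^ 2 * M = β * H) {a : ℝ}
    (h : H ^ 2 - 2 * (l - a) * H - (α * √(δ ^ 2 + M ^ 2)) ^ 2 = 0) : M = modeBound a l α β δ := by
  have hα : 0 < α := hβ.trans hβα
  have hγ := ghGamma_pos hβ hβα
  have hq := quadratic_mode_eq (δ := δ) hβ hβα hE (l - a) 0
  simp only [zero_div, add_zero, sub_zero] at hq
  rw [h, mul_zero] at hq
  have h2 := eq_add_sqrt_of_quadratic_eq_zero hq
    (lt_of_quadratic_nonneg (by positivity) (by positivity) hq.ge).le
  rw [modeBound, mul_comm (δ ^ 2), ← h2]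
  field_simp

variable (hβ : 0 < β) (hβα : β < α) (hM : 0 < M)
  (hE : α ^ 2 * M = β * besselRatio (l - 1 / 2) (α * √(δ ^ 2 + M ^ 2)))

include hβ hβα hM in
theorem mode_argument_pos : 0 < α * √(δ ^ 2 + M ^ 2) := by
  have := hβ.trans hβα
  positivity

include hβ hβα hM hE

theorem modeBound_three_halves_lt : modeBound (3 / 2) l α β δ < M := by
  refine modeBound_lt_of_pos hβ hβα hM hE ?_
  have := besselRatio_lower (mode_argument_pos (δ := δ) hβ hβα hM) (l - 1 / 2)
  convert this using 4
  ring

theorem lt_modeBound_half : M < modeBound (1 / 2) l α β δ :=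
  lt_modeBound_of_neg hβ hβα hE
    (besselRatio_upper (mode_argument_pos (δ := δ) hβ hβα hM) (l - 1 / 2))

theorem lt_modeBound_one (hl : 1 < l) : M < modeBound 1 l α β δ := by
  refine lt_modeBound_of_neg hβ hβα hE ?_
  have := besselRatio_middle_neg (mode_argument_pos (δ := δ) hβ hβα hM)
    (by linarith : 1 / 2 < l - 1 / 2)
  convert this using 4
  ring

theorem modeBound_one_lt (hl : l < 1) : modeBound 1 l α β δ < M := by
  refine modeBound_lt_of_pos hβ hβα hM hE ?_
  have := besselRatio_middle_pos (mode_argument_pos (δ := δ) hβ hβα hM)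
    (by linarith : l - 1 / 2 < 1 / 2)
  convert this using 4
  ring

theorem eq_modeBound_one (hl : l = 1) : M = modeBound 1 l α β δ := by
  subst hl
  refine eq_modeBound_of_zero hβ hβα hM hE ?_
  rw [show (1 : ℝ) - 1 / 2 = 1 / 2 by norm_num,
    besselRatio_half (mode_argument_pos (δ := δ) hβ hβα hM)]
  ring

theorem lt_modeBoundShifted (hl : l < 2) : M < modeBoundShifted l α β δ := by
  have hα : 0 < α := hβ.trans hβα
  have hγ := ghGamma_pos hβ hβα
  have h := besselRatio_shifted_neg (mode_argument_pos (δ := δ) hβ hβα hM)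
    (by linarith : l - 1 / 2 < 3 / 2)
  have hq := quadratic_mode_eq (δ := δ) hβ hβα hE (l - 1) (3 - 2 * l)
  rw [show 2 * (l - 1) = 2 * (l - 1 / 2) - 1 by ring,
    show (3 - 2 * l) = 2 - 2 * (l - 1 / 2) by ring] at hq
  have h1 := hq.trans_lt (mul_neg_of_pos_of_neg (by positivity) h)
  rw [show 2 * (l - 1 / 2) - 1 = 2 * (l - 1) by ring,
    show 2 - 2 * (l - 1 / 2) = (3 - 2 * l) by ring] at h1
  have h2 := lt_add_sqrt_of_quadratic_neg h1
  have h3 : M = β / ghGamma α β ^ 2 * (ghGamma α β ^ 2 * M / β) := by field_simp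
  rw [modeBoundShifted, h3]
  gcongr

/-- For the shifted quadratic the constant term may have the wrong sign, so the larger root is
selected by the bound `b_{3/2}` instead: `r > 2(l - 3/2) ≥ l - 1` when `l ≥ 2`. -/
theorem sub_one_le_of_two_le (hl : 2 ≤ l) : l - 1 < ghGamma α β ^ 2 * M / β := by
  have hγ := ghGamma_pos hβ hβα
  have h := modeBound_three_halves_lt hβ hβα hM hE
  have h3 : M = β / ghGamma α β ^ 2 * (ghGamma α β ^ 2 * M / β) := by field_simp
  rw [modeBound, h3] at h
  have h4 := lt_of_mul_lt_mul_left h (by positivity)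
  have h5 : l - 3 / 2 ≤ √((l - 3 / 2) ^ 2 + δ ^ 2 * ghGamma α β ^ 2) :=
    le_sqrt_of_sq_le (by nlinarith [sq_nonneg (δ * ghGamma α β)])
  linarith

theorem modeBoundShifted_lt (hl : 2 < l) : modeBoundShifted l α β δ < M := by
  have hα : 0 < α := hβ.trans hβα
  have hγ := ghGamma_pos hβ hβα
  have h := besselRatio_shifted_pos (mode_argument_pos (δ := δ) hβ hβα hM)
    (by linarith : 3 / 2 < l - 1 / 2)
  have hq := quadratic_mode_eq (δ := δ) hβ hβα hE (l - 1) (3 - 2 * l)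
  rw [show 2 - 2 * (l - 1 / 2) = (3 - 2 * l) by ring,
    show 2 * (l - 1 / 2) - 1 = 2 * (l - 1) by ring] at h
  have h1 : 0 < (ghGamma α β ^ 2 * M / β) ^ 2 - 2 * (l - 1) * (ghGamma α β ^ 2 * M / β)
      - ghGamma α β ^ 2 * (δ ^ 2 + (3 - 2 * l) / α ^ 2) := hq ▸ mul_pos (by positivity) h
  have h2 := add_sqrt_lt_of_quadratic_pos h1 (sub_one_le_of_two_le hβ hβα hM hE hl.le)
  have h3 : M = β / ghGamma α β ^ 2 * (ghGamma α β ^ 2 * M / β) := by field_simp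
  rw [modeBoundShifted, h3]
  gcongr

theorem eq_modeBoundShifted (hl : l = 2) : M = modeBoundShifted l α β δ := by
  have hα : 0 < α := hβ.trans hβα
  have hγ := ghGamma_pos hβ hβα
  have h := besselRatio_shifted_zero (mode_argument_pos (δ := δ) hβ hβα hM)
  rw [show (3 : ℝ) / 2 = l - 1 / 2 by rw [hl]; norm_num] at h
  have hq := quadratic_mode_eq (δ := δ) hβ hβα hE (l - 1) (3 - 2 * l)
  rw [show 2 - 2 * (l - 1 / 2) = (3 - 2 * l) by ring,
    show 2 * (l - 1 / 2) - 1 = 2 * (l - 1) by ring] at h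
  rw [h, mul_zero] at hq
  have h2 := eq_add_sqrt_of_quadratic_eq_zero hq (sub_one_le_of_two_le hβ hβα hM hE hl.ge).le
  rw [modeBoundShifted, ← h2]
  field_simp

end Bounds

/-! ### Growth of the bounds as `l → ∞` or `δ → ∞`. -/

theorem IsMode.pos_and_eq {l α β δ M : ℝ} (hM : IsMode (ghLaw l α β δ) M) (hβ : 0 < β)
    (hβα : β < α) (h : 0 < δ ∨ δ = 0 ∧ 1 < l) :
    0 < M ∧ α ^ 2 * M = β * besselRatio (l - 1 / 2) (α * √(δ ^ 2 + M ^ 2)) := by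
  obtain ⟨M₀, h0, hE, hiff⟩ := exists_isMode_iff (l := l) hβ hβα h
  rw [(hiff M).1 hM]
  exact ⟨h0, hE⟩

theorem isEquivalent_of_div_tendsto {f : Filter ℝ} {u v w : ℝ → ℝ} {K : ℝ} (hK : K ≠ 0)
    (hw : ∀ᶠ x in f, w x ≠ 0) (hu : Tendsto (fun x => u x / w x) f (𝓝 K))
    (hv : Tendsto (fun x => v x / w x) f (𝓝 K)) : u ~[f] v := by
  refine isEquivalent_of_tendsto_one ?_
  have h := hu.div hv hK
  rw [div_self hK] at h
  refine h.congr' ?_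
  filter_upwards [hw] with x hx
  exact div_div_div_cancel_right₀ hx _ _

/-- The limit does not depend on `a`, so `b_{3/2}` and `b_{1/2}` squeeze the mode. -/
theorem tendsto_modeBound_div_atTop_index (a : ℝ) (α β δ : ℝ) :
    Tendsto (fun l => modeBound a l α β δ / l) atTop (𝓝 (β / ghGamma α β ^ 2 * 2)) := by
  have h0 : ∀ c : ℝ, Tendsto (fun l : ℝ => c / l) atTop (𝓝 0) := fun c =>
    tendsto_const_nhds.div_atTop tendsto_id
  have h1 : Tendsto (fun l : ℝ => 1 - a / l) atTop (𝓝 1) := by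
    simpa using (h0 a).const_sub 1
  have h2 := (h1.add ((h1.pow 2).add ((h0 (δ * ghGamma α β)).pow 2)).sqrt).const_mul
    (β / ghGamma α β ^ 2)
  rw [show (1 : ℝ) + √(1 ^ 2 + 0 ^ 2) = 2 by norm_num] at h2
  refine h2.congr' ?_
  filter_upwards [eventually_gt_atTop 0] with l hl
  have e : (l - a) ^ 2 + δ ^ 2 * ghGamma α β ^ 2 =
      l ^ 2 * ((1 - a / l) ^ 2 + (δ * ghGamma α β / l) ^ 2) := by
    field_simp
  rw [modeBound, e, sqrt_mul (sq_nonneg l), sqrt_sq hl.le]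
  field_simp

theorem tendsto_modeBound_div_atTop_delta (a l α β : ℝ) :
    Tendsto (fun δ => modeBound a l α β δ / δ) atTop
      (𝓝 (β / ghGamma α β ^ 2 * √(ghGamma α β ^ 2))) := by
  have h0 : Tendsto (fun δ : ℝ => (l - a) / δ) atTop (𝓝 0) :=
    tendsto_const_nhds.div_atTop tendsto_id
  have h2 := (h0.add ((h0.pow 2).add_const (ghGamma α β ^ 2)).sqrt).const_mul
    (β / ghGamma α β ^ 2)
  rw [zero_pow two_ne_zero, zero_add, zero_add] at h2
  refine h2.congr' ?_
  filter_upwards [eventually_gt_atTop 0] with δ hδ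
  have e : (l - a) ^ 2 + δ ^ 2 * ghGamma α β ^ 2 =
      δ ^ 2 * (((l - a) / δ) ^ 2 + ghGamma α β ^ 2) := by
    field_simp
  rw [modeBound, e, sqrt_mul (sq_nonneg δ), sqrt_sq hδ.le]
  field_simp

/-! ### Asymptotics of the mode in the parameters `θ`, `σ`. -/

section ThetaSigma

variable {θ σ : ℝ}

theorem thetaSigma_pos (hθ : 0 < θ) (hσ : 0 < σ) : 0 < θ / σ ^ 2 := by positivity

theorem thetaSigma_lt (θ : ℝ) (hσ : 0 < σ) : θ / σ ^ 2 < √(θ ^ 2 + σ ^ 2) / σ ^ 2 := by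
  have : θ < √(θ ^ 2 + σ ^ 2) := lt_sqrt_of_sq_lt (by nlinarith)
  gcongr

theorem ghGamma_thetaSigma (hσ : 0 < σ) :
    ghGamma (√(θ ^ 2 + σ ^ 2) / σ ^ 2) (θ / σ ^ 2) = 1 / σ := by
  rw [ghGamma, div_pow, sq_sqrt (by positivity),
    show (θ ^ 2 + σ ^ 2) / (σ ^ 2) ^ 2 - (θ / σ ^ 2) ^ 2 = (1 / σ) ^ 2 by field_simp; ring,
    sqrt_sq (by positivity)]

theorem modeBound_thetaSigma (hσ : 0 < σ) (a l δ : ℝ) :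
    modeBound a l (√(θ ^ 2 + σ ^ 2) / σ ^ 2) (θ / σ ^ 2) δ =
      θ * (l - a + √((l - a) ^ 2 + δ ^ 2 / σ ^ 2)) := by
  rw [modeBound, ghGamma_thetaSigma hσ]
  have : δ ^ 2 * (1 / σ) ^ 2 = δ ^ 2 / σ ^ 2 := by field_simp
  rw [this]
  field_simp

theorem isMode_thetaSigma {l δ M : ℝ} (hθ : 0 < θ) (hσ : 0 < σ) (h : 0 < δ ∨ δ = 0 ∧ 1 < l)
    (hM : IsMode (ghLawThetaSigma l θ σ δ) M) :
    0 < M ∧ M = θ * σ ^ 2 / (θ ^ 2 + σ ^ 2) *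
        besselRatio (l - 1 / 2) (√(θ ^ 2 + σ ^ 2) / σ ^ 2 * √(δ ^ 2 + M ^ 2)) ∧
      M < θ * (l - 1 / 2 + √((l - 1 / 2) ^ 2 + δ ^ 2 / σ ^ 2)) := by
  have hβ := thetaSigma_pos hθ hσ
  have hβα := thetaSigma_lt θ hσ
  obtain ⟨h0, hE⟩ := IsMode.pos_and_eq hM hβ hβα h
  have hup := lt_modeBound_half hβ hβα h0 hE
  rw [modeBound_thetaSigma hσ] at hup
  refine ⟨h0, ?_, hup⟩
  rw [div_pow, sq_sqrt (by positivity)] at hE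
  field_simp at hE ⊢
  linarith

variable {l δ : ℝ} {M : ℝ → ℝ}

theorem tendsto_prefactor_atTop (θ : ℝ) :
    Tendsto (fun σ => θ * σ ^ 2 / (θ ^ 2 + σ ^ 2)) atTop (𝓝 θ) := by
  have h0 : Tendsto (fun σ : ℝ => θ / σ) atTop (𝓝 0) := tendsto_const_nhds.div_atTop tendsto_id
  have h := (tendsto_const_nhds (x := θ)).div ((h0.pow 2).add_const 1) (by norm_num)
  rw [show θ / (0 ^ 2 + 1) = θ by norm_num] at h
  refine h.congr' ?_
  filter_upwards [eventually_gt_atTop 0] with σ hσ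
  simp only [Pi.div_apply]
  field_simp

theorem tendsto_alpha_mul_sigma (θ : ℝ) :
    Tendsto (fun σ => √(θ ^ 2 + σ ^ 2) / σ ^ 2 * σ) atTop (𝓝 1) := by
  have h0 : Tendsto (fun σ : ℝ => θ / σ) atTop (𝓝 0) := tendsto_const_nhds.div_atTop tendsto_id
  have h := ((h0.pow 2).add_const 1).sqrt
  rw [show √(0 ^ 2 + 1 : ℝ) = 1 by norm_num] at h
  refine h.congr' ?_
  filter_upwards [eventually_gt_atTop 0] with σ hσ
  have e : θ ^ 2 + σ ^ 2 = σ ^ 2 * ((θ / σ) ^ 2 + 1) := by field_simp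
  rw [e, sqrt_mul (sq_nonneg σ), sqrt_sq hσ.le]
  field_simp

/-- The bound `b_{1/2}` keeps the mode bounded for `σ ≥ 1`, while `α` behaves like `1/σ`. -/
theorem tendsto_mode_argument (hθ : 0 < θ) (h : 0 < δ ∨ δ = 0 ∧ 1 < l)
    (hM : ∀ᶠ σ in atTop, IsMode (ghLawThetaSigma l θ σ δ) (M σ)) :
    Tendsto (fun σ => √(θ ^ 2 + σ ^ 2) / σ ^ 2 * √(δ ^ 2 + M σ ^ 2)) atTop (𝓝[>] 0) := by
  refine tendsto_nhdsWithin_iff.2 ⟨?_, ?_⟩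
  · have hα : Tendsto (fun σ => √(θ ^ 2 + σ ^ 2) / σ ^ 2) atTop (𝓝 0) := by
      have h1 := (tendsto_alpha_mul_sigma θ).div_atTop tendsto_id
      refine h1.congr' ?_
      filter_upwards [eventually_gt_atTop 0] with σ hσ
      simp only [id]
      field_simp
    set C := θ * (|l - 1 / 2| + √((l - 1 / 2) ^ 2 + δ ^ 2)) with hC
    refine squeeze_zero' (Eventually.of_forall fun σ => by positivity) ?_
      (by simpa using hα.mul_const (√(δ ^ 2 + C ^ 2)))
    filter_upwards [hM, eventually_ge_atTop 1] with σ hMσ hσ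
    obtain ⟨h0, -, hup⟩ := isMode_thetaSigma hθ (by linarith) h hMσ
    have hσ2 : δ ^ 2 / σ ^ 2 ≤ δ ^ 2 := div_le_self (sq_nonneg δ) (by nlinarith)
    have : M σ ≤ C := by
      refine hup.le.trans ?_
      rw [hC]
      gcongr
      exact le_abs_self _
    gcongr
  · filter_upwards [hM, eventually_gt_atTop 0] with σ hMσ hσ
    exact mode_argument_pos (thetaSigma_pos hθ hσ) (thetaSigma_lt θ hσ)
      (isMode_thetaSigma hθ hσ h hMσ).1

theorem tendsto_mode_of_three_halves_lt (hθ : 0 < θ) (hl : 3 / 2 < l) (hδ : 0 ≤ δ)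
    (hM : ∀ᶠ σ in atTop, IsMode (ghLawThetaSigma l θ σ δ) (M σ)) :
    Tendsto M atTop (𝓝 (θ * (2 * l - 3))) := by
  have h : 0 < δ ∨ δ = 0 ∧ 1 < l := hδ.lt_or_eq.imp id fun h => ⟨h.symm, by linarith⟩
  have h1 := (tendsto_prefactor_atTop θ).mul ((tendsto_besselRatio_of_one_lt
    (by linarith : 1 < l - 1 / 2)).comp (tendsto_mode_argument hθ h hM))
  rw [show 2 * (l - 1 / 2 - 1) = 2 * l - 3 by ring] at h1
  refine h1.congr' ?_
  filter_upwards [hM, eventually_gt_atTop 0] with σ hMσ hσ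
  exact (isMode_thetaSigma hθ hσ h hMσ).2.1.symm

/-- The critical equation gives `M / y^p → θC`. Since `y → 0` this first yields `M → 0`, and then `y
σ → δ`, which replaces `y^p` by `(δ/σ)^p`. -/
theorem tendsto_mode_mul_rpow (hθ : 0 < θ) (hδ : 0 < δ) {p C : ℝ} (hp : 0 < p)
    (hC : Tendsto (fun y => besselRatio (l - 1 / 2) y / y ^ p) (𝓝[>] 0) (𝓝 C))
    (hM : ∀ᶠ σ in atTop, IsMode (ghLawThetaSigma l θ σ δ) (M σ)) :
    Tendsto (fun σ => M σ * σ ^ p) atTop (𝓝 (θ * C * δ ^ p)) := by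
  have harg := tendsto_mode_argument hθ (Or.inl hδ) hM
  have h1 : Tendsto (fun σ => M σ / (√(θ ^ 2 + σ ^ 2) / σ ^ 2 * √(δ ^ 2 + M σ ^ 2)) ^ p) atTop
      (𝓝 (θ * C)) := by
    refine ((tendsto_prefactor_atTop θ).mul (hC.comp harg)).congr' ?_
    filter_upwards [hM, eventually_gt_atTop 0] with σ hMσ hσ
    have h3 := (isMode_thetaSigma hθ hσ (Or.inl hδ) hMσ).2.1
    simp only [Function.comp]
    rw [← mul_div_assoc, ← h3]
  have hpos : ∀ᶠ σ in atTop, 0 < √(θ ^ 2 + σ ^ 2) / σ ^ 2 * √(δ ^ 2 + M σ ^ 2) :=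
    harg.eventually self_mem_nhdsWithin
  have hM0 : Tendsto M atTop (𝓝 0) := by
    have h2 := h1.mul ((harg.mono_right nhdsWithin_le_nhds).rpow_const (Or.inr hp.le))
    rw [zero_rpow hp.ne', mul_zero] at h2
    refine h2.congr' ?_
    filter_upwards [hpos] with σ hσ
    exact div_mul_cancel₀ _ (rpow_pos_of_pos hσ p).ne'
  have hs : Tendsto (fun σ => √(δ ^ 2 + M σ ^ 2)) atTop (𝓝 δ) := by
    have := ((hM0.pow 2).const_add (δ ^ 2)).sqrt
    rwa [zero_pow two_ne_zero, add_zero, sqrt_sq hδ.le] at this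
  have h4 := h1.mul (((tendsto_alpha_mul_sigma θ).mul hs).rpow_const (Or.inr hp.le))
  rw [one_mul] at h4
  refine h4.congr' ?_
  filter_upwards [hpos, eventually_gt_atTop 0] with σ hy hσ
  rw [mul_right_comm, mul_rpow hy.le hσ.le]
  field_simp

theorem tendsto_mode_mul_rpow_of_lt_three_halves (hθ : 0 < θ) (hδ : 0 < δ) (hl : 1 / 2 < l)
    (hl' : l < 3 / 2) (hM : ∀ᶠ σ in atTop, IsMode (ghLawThetaSigma l θ σ δ) (M σ)) :
    Tendsto (fun σ => M σ * σ ^ (3 - 2 * l)) atTop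
      (𝓝 (θ * (2 ^ (2 * l - 2) * Gamma (l - 1 / 2) / Gamma (3 / 2 - l)) * δ ^ (3 - 2 * l))) := by
  have h := tendsto_besselRatio_div_rpow (by linarith : 0 < l - 1 / 2)
    (by linarith : l - 1 / 2 < 1)
  rw [show 2 * (l - 1 / 2) - 1 = 2 * l - 2 by ring, show 1 - (l - 1 / 2) = 3 / 2 - l by ring,
    show 2 - 2 * (l - 1 / 2) = 3 - 2 * l by ring] at h
  exact tendsto_mode_mul_rpow hθ hδ (by linarith) h hM

theorem tendsto_mode_mul_sq (hθ : 0 < θ) (hδ : 0 < δ) (hl : l < 1 / 2)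
    (hM : ∀ᶠ σ in atTop, IsMode (ghLawThetaSigma l θ σ δ) (M σ)) :
    Tendsto (fun σ => M σ * σ ^ 2) atTop (𝓝 (θ * δ ^ 2 / (1 - 2 * l))) := by
  have h := tendsto_besselRatio_div_sq (by linarith : l - 1 / 2 < 0)
  simp_rw [← rpow_two] at h
  have h2 := tendsto_mode_mul_rpow hθ hδ two_pos h hM
  simp_rw [rpow_two] at h2
  convert! h2 using 2
  rw [show -2 * (l - 1 / 2) = 1 - 2 * l by ring]
  ring

theorem tendsto_mode_mul_log (hθ : 0 < θ) (hδ : 0 ≤ δ)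
    (hM : ∀ᶠ σ in atTop, IsMode (ghLawThetaSigma (3 / 2) θ σ δ) (M σ)) :
    Tendsto (fun σ => M σ * log σ) atTop (𝓝 θ) := by
  have h : 0 < δ ∨ δ = 0 ∧ 1 < (3 / 2 : ℝ) := hδ.lt_or_eq.imp id fun h => ⟨h.symm, by norm_num⟩
  have harg := tendsto_mode_argument hθ h hM
  set y : ℝ → ℝ := fun σ => √(θ ^ 2 + σ ^ 2) / σ ^ 2 * √(δ ^ 2 + M σ ^ 2) with hy
  have hL : Tendsto (fun σ => -log (y σ)) atTop atTop :=
    (tendsto_neg_atBot_atTop.comp tendsto_log_nhdsGT_zero).comp harg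
  have h1 : Tendsto (fun σ => M σ * -log (y σ)) atTop (𝓝 θ) := by
    have h2 := (tendsto_prefactor_atTop θ).mul (tendsto_besselRatio_one_mul_log.comp harg)
    rw [mul_one] at h2
    refine h2.congr' ?_
    filter_upwards [hM, eventually_gt_atTop 0] with σ hMσ hσ
    have h3 := (isMode_thetaSigma hθ hσ h hMσ).2.1
    rw [show (3 : ℝ) / 2 - 1 / 2 = 1 by norm_num] at h3
    simp only [Function.comp]
    rw [← mul_assoc, ← h3]
  have hLpos : ∀ᶠ σ in atTop, 0 < -log (y σ) := hL.eventually (eventually_gt_atTop 0)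
  have hM0 : Tendsto M atTop (𝓝 0) := by
    refine (h1.div_atTop hL).congr' ?_
    filter_upwards [hLpos] with σ hσ
    exact mul_div_cancel_right₀ _ hσ.ne'
  have hpos : ∀ᶠ σ in atTop, 0 < M σ := by
    filter_upwards [hM, eventually_gt_atTop 0] with σ hMσ hσ
      using (isMode_thetaSigma hθ hσ h hMσ).1
  -- With `L = -log y`, the passage from `M L → θ` to `M log σ → θ` needs `log σ ~ L`. For `δ > 0`
  -- the square root tends to `δ`; for `δ = 0` it is `M`, and `log M = log (M L) - log L = o(L)`.
  have hlogs : Tendsto (fun σ => log (√(δ ^ 2 + M σ ^ 2)) / -log (y σ)) atTop (𝓝 0) := by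
    rcases hδ.lt_or_eq with hδ | rfl
    · have h3 := ((hM0.pow 2).const_add (δ ^ 2)).sqrt
      rw [zero_pow two_ne_zero, add_zero, sqrt_sq hδ.le] at h3
      exact (h3.log hδ.ne').div_atTop hL
    · have h3 := (isLittleO_log_id_atTop.tendsto_div_nhds_zero).comp hL
      have h4 := ((h1.log hθ.ne').div_atTop hL).sub h3
      rw [sub_zero] at h4
      refine h4.congr' ?_
      filter_upwards [hLpos, hpos] with σ hσ hMσ
      simp only [Function.comp, id]
      rw [← sub_div, log_mul hMσ.ne' hσ.ne', zero_pow two_ne_zero, zero_add, sqrt_sq hMσ.le,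
        add_sub_cancel_right]
  have hlogα : Tendsto (fun σ => log (√(θ ^ 2 + σ ^ 2) / σ ^ 2 * σ) / -log (y σ)) atTop (𝓝 0) :=
    ((tendsto_alpha_mul_sigma θ).log one_ne_zero).div_atTop hL
  have hratio : Tendsto (fun σ => log σ / -log (y σ)) atTop (𝓝 1) := by
    have h3 := (hlogs.add hlogα).const_add 1
    rw [add_zero, add_zero] at h3
    refine h3.congr' ?_
    filter_upwards [hLpos, hpos, eventually_gt_atTop 0] with σ hL' hMσ hσ
    have hα : 0 < √(θ ^ 2 + σ ^ 2) / σ ^ 2 := by positivity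
    have hs : 0 < √(δ ^ 2 + M σ ^ 2) := by positivity
    have e : log (y σ) = log (√(θ ^ 2 + σ ^ 2) / σ ^ 2) + log (√(δ ^ 2 + M σ ^ 2)) :=
      log_mul hα.ne' hs.ne'
    have e2 : log σ = -log (y σ) + (log (√(δ ^ 2 + M σ ^ 2)) +
        log (√(θ ^ 2 + σ ^ 2) / σ ^ 2 * σ)) := by
      rw [e, log_mul hα.ne' hσ.ne']
      ring
    rw [e2, add_div, add_div, div_self hL'.ne']
  have h5 := h1.mul hratio
  rw [mul_one] at h5
  refine h5.congr' ?_
  filter_upwards [hLpos] with σ hσ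
  rw [mul_assoc, mul_div_cancel₀ _ hσ.ne']

/-- For `δ = 0` the equation reads `H(y)/y = α/β`, which tends to `1`; as `H/y` is strictly
decreasing and above `1`, `y → ∞`. With `A = √(θ²+σ²)` it rearranges to `M = θ(1 + θ/A)(H(y) - y)`,
and `H(y) - y → l - 1`. -/
theorem tendsto_mode_nhdsGT_zero (hθ : 0 < θ) (hl : 1 < l)
    (hM : ∀ᶠ σ in 𝓝[>] (0 : ℝ), IsMode (ghLawThetaSigma l θ σ 0) (M σ)) :
    Tendsto M (𝓝[>] 0) (𝓝 (2 * θ * (l - 1))) := by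
  have hν : 1 / 2 < l - 1 / 2 := by linarith
  have hratio : Tendsto (fun σ => √(θ ^ 2 + σ ^ 2) / θ) (𝓝[>] 0) (𝓝 1) := by
    have hc : Continuous fun σ : ℝ => √(θ ^ 2 + σ ^ 2) / θ := by fun_prop
    have := (hc.tendsto 0).mono_left (nhdsWithin_le_nhds (s := Ioi 0))
    rwa [zero_pow two_ne_zero, add_zero, sqrt_sq hθ.le, div_self hθ.ne'] at this
  have hfacts : ∀ᶠ σ in 𝓝[>] (0 : ℝ), 0 < σ ∧ 0 < M σ ∧
      M σ = θ * σ ^ 2 / (θ ^ 2 + σ ^ 2) *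
        besselRatio (l - 1 / 2) (√(θ ^ 2 + σ ^ 2) / σ ^ 2 * M σ) := by
    filter_upwards [hM, self_mem_nhdsWithin] with σ hMσ hσ
    obtain ⟨h0, hE, -⟩ := isMode_thetaSigma hθ hσ (Or.inr ⟨rfl, hl⟩) hMσ
    rw [zero_pow two_ne_zero, zero_add, sqrt_sq h0.le] at hE
    exact ⟨hσ, h0, hE⟩
  set y : ℝ → ℝ := fun σ => √(θ ^ 2 + σ ^ 2) / σ ^ 2 * M σ with hy
  have hyM : ∀ᶠ σ in 𝓝[>] (0 : ℝ), besselRatio (l - 1 / 2) (y σ) / y σ = √(θ ^ 2 + σ ^ 2) / θ := by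
    filter_upwards [hfacts] with σ ⟨hσ, h0, hE⟩
    have hA : 0 < √(θ ^ 2 + σ ^ 2) := by positivity
    have hA2 : √(θ ^ 2 + σ ^ 2) ^ 2 = θ ^ 2 + σ ^ 2 := sq_sqrt (by positivity)
    have hy0 : 0 < y σ := by positivity
    obtain ⟨H, hH⟩ : ∃ H, H = besselRatio (l - 1 / 2) (y σ) := ⟨_, rfl⟩
    have hE' : M σ = θ * σ ^ 2 / (θ ^ 2 + σ ^ 2) * H := by rw [hH]; exact hE
    rw [← hH, div_eq_div_iff hy0.ne' hθ.ne']
    simp only [hy]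
    field_simp at hE' ⊢
    rw [hA2]
    linarith
  have hytop : Tendsto y (𝓝[>] 0) atTop := by
    rw [tendsto_atTop]
    intro Y
    have hY : 0 < max Y 1 := lt_max_of_lt_right one_pos
    have h1 : 1 < besselRatio (l - 1 / 2) (max Y 1) / max Y 1 :=
      (one_lt_div hY).2 (lt_besselRatio hY hν)
    filter_upwards [hratio.eventually (gt_mem_nhds h1), hyM, hfacts] with σ h2 h3 ⟨hσ, h0, _⟩
    rw [← h3] at h2
    have hy0 : 0 < y σ := by positivity
    have := ((strictAntiOn_besselRatio_div hν).lt_iff_gt hy0 hY).1 h2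
    exact (le_max_left _ _).trans this.le
  have hsub := (tendsto_besselRatio_sub (l - 1 / 2)).comp hytop
  have hlim := (((hratio.inv₀ one_ne_zero).const_add 1).const_mul θ).mul hsub
  rw [show θ * (1 + 1⁻¹) * (l - 1 / 2 - 1 / 2) = 2 * θ * (l - 1) by ring] at hlim
  refine hlim.congr' ?_
  filter_upwards [hyM, hfacts] with σ h3 ⟨hσ, h0, _⟩
  have hA : 0 < √(θ ^ 2 + σ ^ 2) := by positivity
  have hA2 : √(θ ^ 2 + σ ^ 2) ^ 2 = θ ^ 2 + σ ^ 2 := sq_sqrt (by positivity)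
  have hy0 : 0 < y σ := by positivity
  rw [div_eq_iff hy0.ne'] at h3
  simp only [Function.comp]
  rw [h3]
  simp only [hy]
  field_simp
  linear_combination hA2

end ThetaSigma

/-! ### Uniqueness of the mode and tightness of the bounds. -/

theorem isMode_unique_of_domain {l α β δ : ℝ} (hβ : 0 < β) (hβα : β < α)
    (h : 0 < δ ∨ δ = 0 ∧ 0 < l) : ∃! M : ℝ, IsMode (ghLaw l α β δ) M := by
  have aux : ∀ M₀, (∀ M, IsMode (ghLaw l α β δ) M ↔ M = M₀) → ∃! M : ℝ, IsMode (ghLaw l α β δ) M :=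
    fun M₀ hiff => ⟨M₀, (hiff M₀).2 rfl, fun M hM => (hiff M).1 hM⟩
  rcases h with h | ⟨rfl, hl⟩
  · obtain ⟨M₀, -, -, hiff⟩ := exists_isMode_iff (l := l) hβ hβα (Or.inl h)
    exact aux M₀ hiff
  · rcases le_or_gt l 1 with hl1 | hl1
    · exact aux 0 (isMode_iff_eq_zero hβ hβα hl hl1)
    · obtain ⟨M₀, -, -, hiff⟩ := exists_isMode_iff (l := l) hβ hβα (Or.inr ⟨rfl, hl1⟩)
      exact aux M₀ hiff

theorem exists_mode_thetaSigma {l θ δ : ℝ} (hθ : 0 < θ) (h : 0 < δ ∨ δ = 0 ∧ 0 < l) :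
    ∃ M : ℝ → ℝ, ∀ σ, 0 < σ → IsMode (ghLawThetaSigma l θ σ δ) (M σ) := by
  have : ∀ σ, ∃ M, 0 < σ → IsMode (ghLawThetaSigma l θ σ δ) M := by
    intro σ
    by_cases hσ : 0 < σ
    · obtain ⟨M, hM, -⟩ := isMode_unique_of_domain (l := l) (thetaSigma_pos hθ hσ)
        (thetaSigma_lt θ hσ) h
      exact ⟨M, fun _ => hM⟩
    · exact ⟨0, fun h => absurd h hσ⟩
  choose M hM using this
  exact ⟨M, hM⟩

theorem isEquivalent_of_squeeze {f : Filter ℝ} {u v M w : ℝ → ℝ} {K : ℝ} (hK : K ≠ 0)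
    (hw : ∀ᶠ x in f, 0 < w x) (hu : Tendsto (fun x => u x / w x) f (𝓝 K))
    (hv : Tendsto (fun x => v x / w x) f (𝓝 K)) (h : ∀ᶠ x in f, u x < M x ∧ M x < v x) :
    u ~[f] M ∧ v ~[f] M := by
  have hM : Tendsto (fun x => M x / w x) f (𝓝 K) := by
    refine tendsto_of_tendsto_of_tendsto_of_le_of_le' hu hv ?_ ?_
    · filter_upwards [hw, h] with x hx hx'
      exact div_le_div_of_nonneg_right hx'.1.le hx.le
    · filter_upwards [hw, h] with x hx hx'
      exact div_le_div_of_nonneg_right hx'.2.le hx.le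
  have hw' : ∀ᶠ x in f, w x ≠ 0 := hw.mono fun x hx => hx.ne'
  exact ⟨isEquivalent_of_div_tendsto hK hw' hu hM, isEquivalent_of_div_tendsto hK hw' hv hM⟩

theorem isEquivalent_div_of_tendsto_mul {f : Filter ℝ} {M g : ℝ → ℝ} {K : ℝ} (hK : K ≠ 0)
    (hg : ∀ᶠ x in f, g x ≠ 0) (h : Tendsto (fun x => M x * g x) f (𝓝 K)) :
    M ~[f] fun x => K / g x := by
  refine isEquivalent_of_div_tendsto (w := fun x => (g x)⁻¹) hK
    (hg.mono fun x hx => inv_ne_zero hx) (by simpa only [div_inv_eq_mul] using h) ?_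
  refine tendsto_const_nhds.congr' ?_
  filter_upwards [hg] with x hx
  field_simp

theorem modeBound_isEquivalent_of_index {α β δ : ℝ} {M : ℝ → ℝ} (hβ : 0 < β) (hβα : β < α)
    (hδ : 0 ≤ δ) (hM : ∀ᶠ l in atTop, IsMode (ghLaw l α β δ) (M l)) :
    (fun l => modeBound (3 / 2) l α β δ) ~[atTop] M ∧
      (fun l => modeBound (1 / 2) l α β δ) ~[atTop] M := by
  have hγ := ghGamma_pos hβ hβα
  refine isEquivalent_of_squeeze (by positivity) (eventually_gt_atTop 0)
    (tendsto_modeBound_div_atTop_index (3 / 2) α β δ)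
    (tendsto_modeBound_div_atTop_index (1 / 2) α β δ) ?_
  filter_upwards [hM, eventually_gt_atTop 1] with l hMl hl
  obtain ⟨h0, hE⟩ := hMl.pos_and_eq hβ hβα (hδ.lt_or_eq.imp id fun h => ⟨h.symm, hl⟩)
  exact ⟨modeBound_three_halves_lt hβ hβα h0 hE, lt_modeBound_half hβ hβα h0 hE⟩

theorem modeBound_isEquivalent_of_delta {l α β : ℝ} {M : ℝ → ℝ} (hβ : 0 < β) (hβα : β < α)
    (hM : ∀ᶠ δ in atTop, IsMode (ghLaw l α β δ) (M δ)) :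
    (fun δ => modeBound (3 / 2) l α β δ) ~[atTop] M ∧
      (fun δ => modeBound (1 / 2) l α β δ) ~[atTop] M := by
  have hγ := ghGamma_pos hβ hβα
  refine isEquivalent_of_squeeze (by positivity) (eventually_gt_atTop 0)
    (tendsto_modeBound_div_atTop_delta (3 / 2) l α β)
    (tendsto_modeBound_div_atTop_delta (1 / 2) l α β) ?_
  filter_upwards [hM, eventually_gt_atTop 0] with δ hMδ hδ
  obtain ⟨h0, hE⟩ := hMδ.pos_and_eq hβ hβα (Or.inl hδ)
  exact ⟨modeBound_three_halves_lt hβ hβα h0 hE, lt_modeBound_half hβ hβα h0 hE⟩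

/-! ### Sharpness of the constants. -/

theorem three_halves_le_of_modeBound_le {a l δ : ℝ} (hl : 3 / 2 < l) (hδ : 0 ≤ δ)
    (h : ∀ α β M : ℝ, 0 < β → β < α → IsMode (ghLaw l α β δ) M → modeBound a l α β δ ≤ M) :
    3 / 2 ≤ a := by
  obtain ⟨M, hM⟩ := exists_mode_thetaSigma (l := l) (δ := δ) one_pos
    (hδ.lt_or_eq.imp id fun h => ⟨h.symm, by linarith⟩)
  have hlim := tendsto_mode_of_three_halves_lt one_pos hl hδ
    ((eventually_gt_atTop 0).mono fun σ hσ => hM σ hσ)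
  have := ge_of_tendsto hlim (b := 2 * (l - a)) ?_
  · linarith
  · filter_upwards [eventually_gt_atTop 0] with σ hσ
    have hb := h _ _ _ (thetaSigma_pos one_pos hσ) (thetaSigma_lt 1 hσ) (hM σ hσ)
    rw [modeBound_thetaSigma hσ] at hb
    have hs : l - a ≤ √((l - a) ^ 2 + δ ^ 2 / σ ^ 2) :=
      le_sqrt_of_sq_le (by have : 0 ≤ δ ^ 2 / σ ^ 2 := by positivity
                           linarith)
    linarith

theorem le_half_of_le_modeBound {a l δ : ℝ} (hl : l < 1 / 2) (hδ : 0 < δ)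
    (h : ∀ α β M : ℝ, 0 < β → β < α → IsMode (ghLaw l α β δ) M → M ≤ modeBound a l α β δ) :
    a ≤ 1 / 2 := by
  by_contra! ha
  obtain ⟨M, hM⟩ := exists_mode_thetaSigma (l := l) (δ := δ) one_pos (Or.inl hδ)
  have hlim := tendsto_mode_mul_sq one_pos hδ hl
    ((eventually_gt_atTop 0).mono fun σ hσ => hM σ hσ)
  have hk : 0 < a - l := by linarith
  have := le_of_tendsto hlim (b := δ ^ 2 / (2 * (a - l))) ?_
  · rw [one_mul, div_le_div_iff₀ (by linarith) (by positivity)] at this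
    have := le_of_mul_le_mul_left this (by positivity)
    linarith
  · filter_upwards [eventually_gt_atTop 0] with σ hσ
    have hb := h _ _ _ (thetaSigma_pos one_pos hσ) (thetaSigma_lt 1 hσ) (hM σ hσ)
    rw [modeBound_thetaSigma hσ] at hb
    -- The tangent-line bound for the root; since `a > l`, the terms `l - a` and `a - l` cancel in
    -- `b_a`, leaving order `σ⁻²`, the order of `M`.
    have hs : √((l - a) ^ 2 + δ ^ 2 / σ ^ 2) ≤ (a - l) + δ ^ 2 / σ ^ 2 / (2 * (a - l)) := by
      rw [sqrt_le_left (by positivity)]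
      have e : ((a - l) + δ ^ 2 / σ ^ 2 / (2 * (a - l))) ^ 2 = (l - a) ^ 2 + δ ^ 2 / σ ^ 2 +
          (δ ^ 2 / σ ^ 2 / (2 * (a - l))) ^ 2 := by
        field_simp
        ring
      rw [e]
      nlinarith [sq_nonneg (δ ^ 2 / σ ^ 2 / (2 * (a - l)))]
    have hb2 : M σ ≤ δ ^ 2 / σ ^ 2 / (2 * (a - l)) := by linarith
    calc M σ * σ ^ 2 ≤ δ ^ 2 / σ ^ 2 / (2 * (a - l)) * σ ^ 2 := by gcongr
      _ = δ ^ 2 / (2 * (a - l)) := by field_simp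

theorem le_one_of_le_modeBound {a l : ℝ} (hl : 1 < l)
    (h : ∀ α β M : ℝ, 0 < β → β < α → IsMode (ghLaw l α β 0) M → M ≤ modeBound a l α β 0) :
    a ≤ 1 := by
  obtain ⟨M, hM⟩ := exists_mode_thetaSigma (l := l) (δ := 0) one_pos (Or.inr ⟨rfl, by linarith⟩)
  have hlim := tendsto_mode_nhdsGT_zero one_pos hl
    (by filter_upwards [self_mem_nhdsWithin] with σ hσ using hM σ hσ)
  have := le_of_tendsto hlim (b := l - a + |l - a|) ?_
  · rcases abs_cases (l - a) with h | h <;> linarith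
  · filter_upwards [self_mem_nhdsWithin] with σ hσ
    have hb := h _ _ _ (thetaSigma_pos one_pos hσ) (thetaSigma_lt 1 hσ) (hM σ hσ)
    rw [modeBound_thetaSigma hσ, zero_pow two_ne_zero, zero_div, add_zero, sqrt_sq_eq_abs] at hb
    linarith

theorem le_one_of_le_modeBound_of_pos {a : ℝ}
    (h : ∀ l α β δ M : ℝ, 1 < l → 0 < β → β < α → 0 < δ → IsMode (ghLaw l α β δ) M →
      M ≤ modeBound a l α β δ) : a ≤ 1 := by
  by_contra! ha
  have ha' : 0 < a - 1 := by linarith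
  -- At `l = 2` the shifted identity gives `H² - 2(2-a)H - y² = 2(a-1)H - 1`. With `δ = 1` one has
  -- `H > y ≥ α`, so this `α` makes the right side positive and `b_a < M`.
  set α := 1 / (2 * (a - 1)) with hα
  have hα0 : 0 < α := by positivity
  have hβ : 0 < α / 2 := half_pos hα0
  have hβα : α / 2 < α := half_lt_self hα0
  obtain ⟨M, h0, hE, hiff⟩ := exists_isMode_iff (l := 2) (δ := 1) hβ hβα (Or.inl one_pos)
  have hy := mode_argument_pos (δ := 1) hβ hβα h0
  have hle := h 2 α (α / 2) 1 M one_lt_two hβ hβα one_pos ((hiff M).2 rfl)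
  rw [show (2 : ℝ) - 1 / 2 = 3 / 2 by norm_num] at hE
  refine hle.not_gt (modeBound_lt_of_pos hβ hβα h0 hE ?_)
  have hz := besselRatio_shifted_zero hy
  have hlt := lt_besselRatio hy (by norm_num : (1 : ℝ) / 2 < 3 / 2)
  have hs : α * 1 ≤ α * √(1 ^ 2 + M ^ 2) := by
    gcongr
    exact one_le_sqrt.2 (by nlinarith)
  have hmul : 2 * (a - 1) * α = 1 := by rw [hα]; field_simp
  rw [mul_one] at hs
  have h2 := mul_lt_mul_of_pos_left (hs.trans_lt hlt) (by positivity : 0 < 2 * (a - 1))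
  rw [hmul] at h2
  nlinarith

theorem theorem1 :
    -- the mode exists and is unique on the whole parameter domain
    (∀ l α β δ : ℝ, 0 < β → β < α → (0 < δ ∨ (δ = 0 ∧ 0 < l)) →
      ∃! M : ℝ, IsMode (ghLaw l α β δ) M) ∧
    -- (i), `δ > 0`
    (∀ l α β δ M : ℝ, 0 < β → β < α → 0 < δ → IsMode (ghLaw l α β δ) M →
      modeBound (3 / 2) l α β δ < M ∧ M < modeBound (1 / 2) l α β δ ∧
      (1 < l → M < modeBound 1 l α β δ) ∧
      (l = 1 → M = modeBound 1 l α β δ) ∧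
      (l < 1 → modeBound 1 l α β δ < M) ∧
      (2 < l → modeBoundShifted l α β δ < M) ∧
      (l = 2 → M = modeBoundShifted l α β δ) ∧
      (l < 2 → M < modeBoundShifted l α β δ)) ∧
    -- (i), `δ = 0`
    (∀ l α β M : ℝ, 0 < β → β < α → 0 < l → IsMode (ghLaw l α β 0) M →
      (3 / 2 < l → modeBound (3 / 2) l α β 0 < M) ∧
      (1 / 2 < l → M < modeBound (1 / 2) l α β 0) ∧
      (1 < l → M < modeBound 1 l α β 0) ∧
      (l = 1 → M = modeBound 1 l α β 0 ∧ M = 0) ∧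
      (2 < l → modeBoundShifted l α β 0 < M) ∧
      (l = 2 → M = modeBoundShifted l α β 0) ∧
      (1 < l → l < 2 → M < modeBoundShifted l α β 0)) ∧
    -- (ii), tightness of the two-sided inequality as `l → ∞`
    (∀ (α β δ : ℝ) (M : ℝ → ℝ), 0 < β → β < α → 0 ≤ δ →
      (∀ᶠ l in atTop, IsMode (ghLaw l α β δ) (M l)) →
      (fun l => modeBound (3 / 2) l α β δ) ~[atTop] M ∧
      (fun l => modeBound (1 / 2) l α β δ) ~[atTop] M) ∧
    -- (ii), tightness of the two-sided inequality as `δ → ∞`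
    (∀ (l α β : ℝ) (M : ℝ → ℝ), 0 < β → β < α →
      (∀ᶠ δ in atTop, IsMode (ghLaw l α β δ) (M δ)) →
      (fun δ => modeBound (3 / 2) l α β δ) ~[atTop] M ∧
      (fun δ => modeBound (1 / 2) l α β δ) ~[atTop] M) ∧
    -- (ii), `σ → ∞` for fixed `θ`
    (∀ (l θ δ : ℝ) (M : ℝ → ℝ), 0 < θ →
      (∀ᶠ σ in atTop, IsMode (ghLawThetaSigma l θ σ δ) (M σ)) →
      (3 / 2 < l → 0 ≤ δ → M ~[atTop] fun _ => θ * (2 * l - 3)) ∧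
      (l = 3 / 2 → 0 ≤ δ → M ~[atTop] fun σ => θ / log σ) ∧
      (1 / 2 < l → l < 3 / 2 → 0 < δ →
        M ~[atTop] fun σ =>
          2 ^ (2 * l - 2) * Gamma (l - 1 / 2) / Gamma (3 / 2 - l)
            * (θ * δ ^ (3 - 2 * l) / σ ^ (3 - 2 * l))) ∧
      (l < 1 / 2 → 0 < δ → M ~[atTop] fun σ => θ * δ ^ 2 / ((1 - 2 * l) * σ ^ 2))) ∧
    -- (ii), `δ = 0`, `0 < l ≤ 1`
    (∀ l α β M : ℝ, 0 < β → β < α → 0 < l → l ≤ 1 → IsMode (ghLaw l α β 0) M → M = 0) ∧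
    -- (ii), `δ = 0`, `l > 1`, `σ ↓ 0` for fixed `θ`
    (∀ (l θ : ℝ) (M : ℝ → ℝ), 0 < θ → 1 < l →
      (∀ᶠ σ in 𝓝[>] (0 : ℝ), IsMode (ghLawThetaSigma l θ σ 0) (M σ)) →
      M ~[𝓝[>] (0 : ℝ)] fun _ => 2 * θ * (l - 1)) ∧
    -- (ii), the lower bound with `a = 3/2` is best possible
    (∀ a l δ : ℝ, 3 / 2 < l → 0 ≤ δ →
      (∀ α β M : ℝ, 0 < β → β < α → IsMode (ghLaw l α β δ) M → modeBound a l α β δ ≤ M) →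
      3 / 2 ≤ a) ∧
    -- (ii), the upper bound with `a = 1/2` is best possible
    (∀ a l δ : ℝ, l < 1 / 2 → 0 < δ →
      (∀ α β M : ℝ, 0 < β → β < α → IsMode (ghLaw l α β δ) M → M ≤ modeBound a l α β δ) →
      a ≤ 1 / 2) ∧
    -- (ii), the upper bound with `a = 1` for `l > 1` is best possible, for `δ = 0` and for `δ > 0`
    (∀ a l : ℝ, 1 < l →
      (∀ α β M : ℝ, 0 < β → β < α → IsMode (ghLaw l α β 0) M → M ≤ modeBound a l α β 0) →
      a ≤ 1) ∧
    (∀ a : ℝ,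
      (∀ l α β δ M : ℝ, 1 < l → 0 < β → β < α → 0 < δ → IsMode (ghLaw l α β δ) M →
        M ≤ modeBound a l α β δ) →
      a ≤ 1) := by
  refine ⟨fun l α β δ hβ hβα h => isMode_unique_of_domain hβ hβα h, ?_, ?_,
    fun α β δ M hβ hβα hδ hM => modeBound_isEquivalent_of_index hβ hβα hδ hM,
    fun l α β M hβ hβα hM => modeBound_isEquivalent_of_delta hβ hβα hM, ?_,
    fun l α β M hβ hβα hl hl1 hM => (isMode_iff_eq_zero hβ hβα hl hl1 M).1 hM, ?_,
    fun a l δ hl hδ h => three_halves_le_of_modeBound_le hl hδ h,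
    fun a l δ hl hδ h => le_half_of_le_modeBound hl hδ h,
    fun a l hl h => le_one_of_le_modeBound hl h, fun a h => le_one_of_le_modeBound_of_pos h⟩
  · intro l α β δ M hβ hβα hδ hM
    obtain ⟨h0, hE⟩ := hM.pos_and_eq hβ hβα (Or.inl hδ)
    exact ⟨modeBound_three_halves_lt hβ hβα h0 hE, lt_modeBound_half hβ hβα h0 hE,
      lt_modeBound_one hβ hβα h0 hE, eq_modeBound_one hβ hβα h0 hE, modeBound_one_lt hβ hβα h0 hE,
      modeBoundShifted_lt hβ hβα h0 hE, eq_modeBoundShifted hβ hβα h0 hE,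
      lt_modeBoundShifted hβ hβα h0 hE⟩
  · intro l α β M hβ hβα hl hM
    rcases le_or_gt l 1 with hl1 | hl1
    · have hM0 := (isMode_iff_eq_zero hβ hβα hl hl1 M).1 hM
      have hγ := ghGamma_pos hβ hβα
      refine ⟨fun h => by linarith, fun h => ?_, fun h => by linarith, fun h => ⟨?_, hM0⟩,
        fun h => by linarith, fun h => by linarith, fun h => by linarith⟩
      · have : 0 < l - 1 / 2 := by linarith
        rw [hM0, modeBound]
        positivity
      · rw [hM0, modeBound, h]
        simp
    · obtain ⟨h0, hE⟩ := hM.pos_and_eq hβ hβα (Or.inr ⟨rfl, hl1⟩)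
      exact ⟨fun _ => modeBound_three_halves_lt hβ hβα h0 hE,
        fun _ => lt_modeBound_half hβ hβα h0 hE, lt_modeBound_one hβ hβα h0 hE,
        fun h => absurd h hl1.ne', modeBoundShifted_lt hβ hβα h0 hE,
        eq_modeBoundShifted hβ hβα h0 hE, fun _ => lt_modeBoundShifted hβ hβα h0 hE⟩
  · intro l θ δ M hθ hM
    refine ⟨fun hl hδ => ?_, ?_, fun hl hl' hδ => ?_, fun hl hδ => ?_⟩
    · exact (isEquivalent_const_iff_tendsto (mul_pos hθ (by linarith)).ne').2
        (tendsto_mode_of_three_halves_lt hθ hl hδ hM)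
    · rintro rfl hδ
      exact isEquivalent_div_of_tendsto_mul hθ.ne'
        ((eventually_gt_atTop 1).mono fun σ hσ => (log_pos hσ).ne')
        (tendsto_mode_mul_log hθ hδ hM)
    · have h1 := Gamma_pos_of_pos (by linarith : 0 < l - 1 / 2)
      have h2 := Gamma_pos_of_pos (by linarith : 0 < 3 / 2 - l)
      refine (isEquivalent_div_of_tendsto_mul (by positivity)
        ((eventually_gt_atTop 0).mono fun σ hσ => (rpow_pos_of_pos hσ _).ne')
        (tendsto_mode_mul_rpow_of_lt_three_halves hθ hδ hl hl' hM)).trans_eventuallyEq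
        (Eventually.of_forall fun σ => ?_)
      beta_reduce
      ring
    · have h1 : 0 < 1 - 2 * l := by linarith
      refine (isEquivalent_div_of_tendsto_mul (by positivity)
        ((eventually_gt_atTop 0).mono fun σ hσ => pow_ne_zero 2 (ne_of_gt hσ))
        (tendsto_mode_mul_sq hθ hδ hl hM)).trans_eventuallyEq (Eventually.of_forall fun σ => ?_)
      exact div_div _ _ _
  · intro l θ M hθ hl hM
    have : 2 * θ * (l - 1) ≠ 0 := (mul_pos (by positivity) (by linarith)).ne'
    exact (isEquivalent_const_iff_tendsto this).2 (tendsto_mode_nhdsGT_zero hθ hl hM)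

end
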